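/- Let $X$ be a Euclidean space with closed unit ball $B$ and let $f\colon X\to\mathbb R$ be locally Lipschitz. The Clarke subdifferential $\partial f(x)$ is the closed convex hull of all limits $\lim_r\nabla f(x_r)$ along sequences $x_r\to x$ of points of differentiability of $f$. For $\varepsilon\ge0$, let $\partial_\varepsilon f(x)=\operatorname{conv}\big(\partial f(x+\varepsilon B)\big)$; the Goldstein subgradient $g_\varepsilon(x)$ is the shortest vector in $\partial_\varepsilon f(x)$. The function $f$ has the *Goldstein property* at $\bar x$ if there are constants $\nu>\mu>0$ and $\theta\in(0,1)$ such that, for every $x\ne\bar x$ near $\bar x$ and every $\varepsilon$ with $\mu\le\varepsilon/|x-\bar x|\le\nu$, the vector $g=g_\varepsilon(x)$ is nonzero and the point $x^+=x-\varepsilon\frac{g}{|g|}$ satisfies $f(x^+)-f(\bar x)\le\theta\big(f(x)-f(\bar x)\big)$ or $|x^+-\bar x|\le\theta|x-\bar x|$. In that case $[\mu,\nu]$ is called a *proportionality bracket*. Let $M\subset X$ be a $C^2$-smooth manifold around $\bar x\in M$ (near $\bar x$, it is the zero set of a $C^2$ map with surjective derivative at $\bar x$), let $d_M$ be the distance to $M$,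 and for $x$ near $\bar x$ let $P_M(x)$ be the nearest point to $x$ in $M$. The function $f$ *grows robustly* relative to $M$ at $\bar x$ if: (a) for some $\delta>0$, $f(x)-f(\bar x)\ge\frac\delta2|x-\bar x|^2$ for all $x$ near $\bar x$; (b) $f$ is subdifferentially regular at every $x\in M$, that is, $\lim_{t\downarrow0}\frac1t\big(f(x+ty)-f(x)\big)=\max_{v\in\partial f(x)}\langle v,y\rangle$ for all $y\in X$; (c) the restriction $f|_M$ is $C^2$-smooth around $\bar x$; (d) for some $K>0$, $\partial f(y)\subset\partial f(x)+K|x-y|B$ for all $x\in M$ and $y\in X$ near $\bar x$; (e) for some $\mu>0$, $\langle v,x-P_M(x)\rangle\ge\mu\, d_M(x)$ for all $x$ near $\bar x$ and all $v\in\partial f(x)$. Let $\nabla_M f$ be the Riemannian gradient of $f|_M$ (with the metric induced from $X$). The function $f$ has *tempered growth* at $\bar x$ relative to $M$ if, for every angle $\theta>0$, for all sufficiently small $\beta>0$: whenever $\bar x\ne x_r\to\bar x$, $0\le\varepsilon_r\le\beta|x_r-\bar x|$ and $g_{\varepsilon_r}(x_r)\to0$, the vectors $g_{\varepsilon_r}(x_r)$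 and $\nabla_M f\big(P_M(x_r)\big)$ are eventually nonzero and subtend an angle less than $\theta$. **Theorem.** Let $M\subset X$ be a $C^2$-smooth manifold around $\bar x\in M$, and let the locally Lipschitz function $f\colon X\to\mathbb R$ grow robustly and have tempered growth at $\bar x$ relative to $M$. Then $f$ has the Goldstein property at $\bar x$. Moreover, given any $\gamma\in(0,1)$, for all sufficiently small $\beta>0$ the following hold. 1. The interval $[\beta\gamma,\beta]$ is a proportionality bracket for $f$ at $\bar x$. 2. For every $x_0$ sufficiently near $\bar x$ and every sequence $(x_r)$ starting at $x_0$ and generated by the rule $$x_{r+1}=x_r-\varepsilon\frac{g}{|g|}\quad\text{for any }\varepsilon\text{ with }\gamma\le\frac{\varepsilon}{\beta|x_r-\bar x|}\le1,\qquad g=g_\varepsilon(x_r),$$ as long as $x_r\ne\bar x$ (with $x_{r+1}=\bar x$ if $x_r=\bar x$), there are constants $a,b>0$ such that $|x_r-\bar x|\le a\,e^{-b\sqrt r}$ for all $r$. -/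

import Mathlib

open Filter Topology
open scoped Pointwise

noncomputable section

variable {X : Type*} [NormedAddCommGroup X] [InnerProductSpace ℝ X] [FiniteDimensional ℝ X]

/-- The Clarke subdifferential `∂f(x)`: the closed convex hull of all limits of gradients
`∇f(u r)` along sequences `u r → x` of points of differentiability of `f`. -/
def clarkeSubdifferential (f : X → ℝ) (x : X) : Set X :=
  closedConvexHull ℝ {v : X | ∃ u : ℕ → X, Tendsto u atTop (𝓝 x) ∧
    (∀ r, DifferentiableAt ℝ f (u r)) ∧ Tendsto (fun r => gradient f (u r)) atTop (𝓝 v)}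

/-- The Goldstein subdifferential `∂_ε f(x) = conv (∂f(x + εB))`, where `B` is the closed
unit ball. -/
def goldsteinSubdifferential (f : X → ℝ) (ε : ℝ) (x : X) : Set X :=
  convexHull ℝ (⋃ y ∈ Metric.closedBall x ε, clarkeSubdifferential f y)

/-- The shortest vector in a set (meaningful when it exists and is unique, as it is for a
nonempty compact convex set). -/
def shortestVector (S : Set X) : X :=
  Classical.epsilon fun g => g ∈ S ∧ ∀ v ∈ S, ‖g‖ ≤ ‖v‖

/-- The Goldstein subgradient `g_ε(x)`: the shortest vector in `∂_ε f(x)`. -/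
def goldsteinSubgradient (f : X → ℝ) (ε : ℝ) (x : X) : X :=
  shortestVector (goldsteinSubdifferential f ε x)

/-- The Goldstein update `x - ε g / |g|`, where `g = g_ε(x)`. -/
def goldsteinUpdate (f : X → ℝ) (ε : ℝ) (x : X) : X :=
  x - (ε / ‖goldsteinSubgradient f ε x‖) • goldsteinSubgradient f ε x

/-- `f` grows quadratically at `xbar`. -/
def GrowsQuadratically (f : X → ℝ) (xbar : X) : Prop :=
  ∃ δ : ℝ, 0 < δ ∧ ∀ᶠ x in 𝓝 xbar, δ / 2 * ‖x - xbar‖ ^ 2 ≤ f x - f xbar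

/-- `[μ, ν]` is a proportionality bracket for `f` at `xbar`. -/
def IsProportionalityBracket (f : X → ℝ) (xbar : X) (μ ν : ℝ) : Prop :=
  0 < μ ∧ μ < ν ∧ ∃ θ ∈ Set.Ioo (0 : ℝ) 1, ∀ᶠ x in 𝓝 xbar, x ≠ xbar →
    ∀ ε : ℝ, μ ≤ ε / ‖x - xbar‖ → ε / ‖x - xbar‖ ≤ ν →
      goldsteinSubgradient f ε x ≠ 0 ∧
      (f (goldsteinUpdate f ε x) - f xbar ≤ θ * (f x - f xbar) ∨
        ‖goldsteinUpdate f ε x - xbar‖ ≤ θ * ‖x - xbar‖)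

/-- `f` has the Goldstein property at `xbar`. -/
def HasGoldsteinProperty (f : X → ℝ) (xbar : X) : Prop :=
  ∃ μ ν : ℝ, IsProportionalityBracket f xbar μ ν

/-- `M` is a `C²`-smooth manifold around `xbar ∈ M`: near `xbar` it is the zero set of a
`C²`-smooth map whose derivative at `xbar` is surjective. -/
def IsC2ManifoldAround (M : Set X) (xbar : X) : Prop :=
  xbar ∈ M ∧ ∃ (k : ℕ) (F : X → EuclideanSpace ℝ (Fin k)), ContDiffAt ℝ 2 F xbar ∧
    Function.Surjective (fderiv ℝ F xbar) ∧ ∀ᶠ x in 𝓝 xbar, (x ∈ M ↔ F x = 0)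

/-- The nearest point `P_M(x)` to `x` in `M` (meaningful when it exists and is unique, as it
does for `x` near `xbar` when `M` is a `C²`-smooth manifold around `xbar`). -/
def nearestPoint (M : Set X) (x : X) : X :=
  Classical.epsilon fun y => y ∈ M ∧ dist x y = Metric.infDist x M

/-- The restriction of `f` to `M` is `C²`-smooth around `xbar`: near `xbar` it agrees on `M`
with a function that is `C²`-smooth on a neighborhood of `xbar` in the ambient space. -/
def RestrictionIsC2Around (f : X → ℝ) (M : Set X) (xbar : X) : Prop :=
  ∃ h : X → ℝ, ContDiffAt ℝ 2 h xbar ∧ ∀ᶠ x in 𝓝 xbar, x ∈ M → f x = h x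

/-- The tangent space to `M` at `y`: the span of the tangent cone (for a manifold around `y`,
the tangent cone is already a subspace). -/
def tangentSpaceAt (M : Set X) (y : X) : Submodule ℝ X :=
  Submodule.span ℝ (tangentConeAt ℝ M y)

/-- The Riemannian gradient `∇_M f(y)` of `f|_M` at `y ∈ M`, for the metric induced from `X`:
the tangent vector `v` that represents the derivative of `f|_M` at `y`, in the sense that
`f(z) = f(y) + ⟨v, z - y⟩ + o(|z - y|)` as `z → y` in `M`. -/
def riemannianGradient (f : X → ℝ) (M : Set X) (y : X) : X :=
  Classical.epsilon fun v => v ∈ tangentSpaceAt M y ∧ HasGradientWithinAt f v M y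

/-- The Clarke directional derivative `f°(x; y) = max {⟨v, y⟩ : v ∈ ∂f(x)}`. -/
def clarkeDirectionalDerivative (f : X → ℝ) (x y : X) : ℝ :=
  sSup ((fun v : X => inner ℝ v y) '' clarkeSubdifferential f x)

/-- `f` is subdifferentially regular at `x`. -/
def IsSubdifferentiallyRegularAt (f : X → ℝ) (x : X) : Prop :=
  ∀ y : X, Tendsto (fun t : ℝ => (f (x + t • y) - f x) / t) (𝓝[>] 0)
    (𝓝 (clarkeDirectionalDerivative f x y))

/-- `∂f` is upper Lipschitz relative to `M` at `xbar`. -/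
def IsUpperLipschitz (f : X → ℝ) (M : Set X) (xbar : X) : Prop :=
  ∃ K : ℝ, 0 < K ∧ ∃ ρ : ℝ, 0 < ρ ∧
    ∀ x ∈ M ∩ Metric.ball xbar ρ, ∀ y ∈ Metric.ball xbar ρ,
      clarkeSubdifferential f y ⊆
        clarkeSubdifferential f x + Metric.closedBall (0 : X) (K * ‖x - y‖)

/-- The aiming condition for `f` relative to `M` at `xbar`. -/
def AimingCondition (f : X → ℝ) (M : Set X) (xbar : X) : Prop :=
  ∃ μ : ℝ, 0 < μ ∧ ∀ᶠ x in 𝓝 xbar, ∀ v ∈ clarkeSubdifferential f x,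
    μ * Metric.infDist x M ≤ inner ℝ v (x - nearestPoint M x)

/-- `f` grows robustly relative to `M` at `xbar`. -/
structure GrowsRobustly (f : X → ℝ) (M : Set X) (xbar : X) : Prop where
  growsQuadratically : GrowsQuadratically f xbar
  regular : ∀ x ∈ M, IsSubdifferentiallyRegularAt f x
  restriction : RestrictionIsC2Around f M xbar
  upperLipschitz : IsUpperLipschitz f M xbar
  aiming : AimingCondition f M xbar

/-- `f` has tempered growth at `xbar` relative to `M`: given any angle `θ > 0`, for all
sufficiently small `β > 0`, whenever `xbar ≠ x r → xbar` and `0 ≤ ε r ≤ β |x r - xbar|` with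
`g_{ε r}(x r) → 0`, these Goldstein subgradients and the Riemannian gradients
`∇_M f(P_M(x r))` are eventually nonzero and subtend an angle less than `θ`. -/
def HasTemperedGrowth (f : X → ℝ) (M : Set X) (xbar : X) : Prop :=
  ∀ θ : ℝ, 0 < θ → ∀ᶠ β : ℝ in 𝓝[>] 0, ∀ (x : ℕ → X) (ε : ℕ → ℝ),
    (∀ r, x r ≠ xbar) → Tendsto x atTop (𝓝 xbar) →
    (∀ r, 0 ≤ ε r ∧ ε r ≤ β * ‖x r - xbar‖) →
    Tendsto (fun r => goldsteinSubgradient f (ε r) (x r)) atTop (𝓝 0) →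
    ∀ᶠ r in atTop,
      goldsteinSubgradient f (ε r) (x r) ≠ 0 ∧
      riemannianGradient f M (nearestPoint M (x r)) ≠ 0 ∧
      InnerProductGeometry.angle (goldsteinSubgradient f (ε r) (x r))
        (riemannianGradient f M (nearestPoint M (x r))) < θ

/-- `x` is generated by Goldstein iterations: an iterate `x r ≠ xbar` is replaced by the
Goldstein update for some step size `ε` with `γ ≤ ε / (β |x r - xbar|) ≤ 1`; once `xbar` is
reached, the sequence stays there. -/
def IsGoldsteinIteration (f : X → ℝ) (xbar : X) (γ β : ℝ) (x : ℕ → X) : Prop :=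
  ∀ r, (x r = xbar → x (r + 1) = xbar) ∧
    (x r ≠ xbar → ∃ ε : ℝ, γ ≤ ε / (β * ‖x r - xbar‖) ∧ ε / (β * ‖x r - xbar‖) ≤ 1 ∧
      x (r + 1) = goldsteinUpdate f ε (x r))

/-- Nearly linear convergence, in the form `|x r - xbar| ≤ a * exp (-b * √r)`. -/
def ConvergesNearlyLinearly (x : ℕ → X) (xbar : X) : Prop :=
  ∃ a b : ℝ, 0 < a ∧ 0 < b ∧ ∀ r : ℕ, ‖x r - xbar‖ ≤ a * Real.exp (-b * √(r : ℝ))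

end

/-!
Near `xbar`, a Goldstein update falls into one of two regimes.

If the Goldstein subgradient `g` has norm at least a fixed `c > 0`, the update decreases `f` by
`ε * ‖g‖` (`goldsteinUpdate_descent`). This is proportional to `‖x - xbar‖`, hence, by the Lipschitz
property, to `f x - f xbar`, so `f - f xbar` shrinks by a fixed factor. The descent inequality is
a one-sided Lebourg mean value theorem, obtained from Rademacher's theorem and Fubini's theorem.

If `g` is small, the aiming condition forces `x` to lie within `O(ε)` of `M`
(`exists_le_norm_goldsteinSubgradient_of_lt_infDist`). This needs only the `C¹` geometry of nearest
points (`IsStraightening.norm_nearestPoint_sub_le`), in a chart that straightens `M` to its tangent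
space at `xbar`. Tempered growth then aligns `g` with the Riemannian gradient of `f` at the nearest
point. In the chart, quadratic growth makes the Hessian of `f` along `M` positive definite, so the
Riemannian gradient makes an angle with the outward radial direction that is bounded away from
a right angle (`IsStraightening.exists_inner_riemannianGradient_ge`). For small `β`, the update
therefore contracts `‖x - xbar‖` by a fixed factor. Together these give the Goldstein property
(`eventually_isProportionalityBracket`).

For the rate, `f` never increases along the iterates. If the first `s ^ 2` steps are cut into `s`
blocks of length `s`, then either every block contains a step contracting `f - f xbar`, or some
block contracts the distance `s` times in a row. Both bound `f - f xbar` by a constant times `θ ^ s`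
(`le_mul_pow_sqrt_of_alternating_contraction`), and quadratic growth transfers this bound to
`‖x - xbar‖`.
-/

/-! ### Convex hulls and shortest vectors -/

/-- By Carathéodory's theorem, the convex hull is a finite union of continuous images of products
of a standard simplex with a power of the set. -/
theorem IsCompact.convexHull_of_finiteDimensional {E : Type*} [NormedAddCommGroup E]
    [NormedSpace ℝ E] [FiniteDimensional ℝ E] {s : Set E} (hs : IsCompact s) :
    IsCompact (convexHull ℝ s) := by
  have key : convexHull ℝ s = ⋃ n ∈ Finset.range (Module.finrank ℝ E + 2),
      (fun p : (Fin n → ℝ) × (Fin n → E) => ∑ i, p.1 i • p.2 i) ''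
        (stdSimplex ℝ (Fin n) ×ˢ Set.pi Set.univ fun _ => s) := by
    apply Set.Subset.antisymm
    · intro x hx
      obtain ⟨ι, _, z, w, hz, hind, hw, hw1, hx⟩ := eq_pos_convex_span_of_mem_convexHull hx
      have hcard := hind.card_le_finrank_succ
      have hle : Module.finrank ℝ (vectorSpan ℝ (Set.range z)) ≤ Module.finrank ℝ E :=
        Submodule.finrank_le _
      let e := Fintype.equivFin ι
      simp only [Set.mem_iUnion, Finset.mem_range]
      refine ⟨Fintype.card ι, by omega, (w ∘ e.symm, z ∘ e.symm), ⟨⟨?_, ?_⟩, ?_⟩, ?_⟩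
      · exact fun i => (hw _).le
      · rw [← hw1]; exact Equiv.sum_comp e.symm w
      · exact fun i _ => hz ⟨_, rfl⟩
      · rw [← hx]; exact Equiv.sum_comp e.symm fun i => w i • z i
    · simp only [Set.iUnion_subset_iff]
      rintro n - _ ⟨⟨w, z⟩, ⟨⟨hw0, hw1⟩, hz⟩, rfl⟩
      exact (convex_convexHull ℝ s).sum_mem (fun i _ => hw0 i) hw1
        fun i _ => subset_convexHull ℝ s (hz i trivial)
  rw [key]
  refine Finset.isCompact_biUnion _ fun n _ => IsCompact.image ?_ (by fun_prop)
  exact (isCompact_stdSimplex ℝ (Fin n)).prod (isCompact_univ_pi fun _ => hs)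

section

variable {X : Type*} [NormedAddCommGroup X] [InnerProductSpace ℝ X]

theorem shortestVector_spec {S : Set X} (hne : S.Nonempty) (hcomp : IsCompact S)
    (hconv : Convex ℝ S) :
    shortestVector S ∈ S ∧
      ∀ v ∈ S, ‖shortestVector S‖ ^ 2 ≤ inner ℝ (shortestVector S) v := by
  obtain ⟨g, hg, hmin⟩ := hcomp.exists_isMinOn hne continuous_norm.continuousOn
  have hspec : shortestVector S ∈ S ∧ ∀ v ∈ S, ‖shortestVector S‖ ≤ ‖v‖ :=
    Classical.epsilon_spec (p := fun g => g ∈ S ∧ ∀ v ∈ S, ‖g‖ ≤ ‖v‖) ⟨g, hg, hmin⟩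
  refine ⟨hspec.1, fun v hv => ?_⟩
  set w := shortestVector S with hw
  have : Nonempty S := ⟨⟨w, hspec.1⟩⟩
  have hinf : ‖0 - w‖ = ⨅ u : S, ‖(0 : X) - u‖ := by
    apply le_antisymm
    · exact le_ciInf fun u => by simpa using hspec.2 u u.2
    · exact ciInf_le ⟨0, by rintro _ ⟨u, rfl⟩; positivity⟩ (⟨w, hspec.1⟩ : S)
  have := (norm_eq_iInf_iff_real_inner_le_zero hconv hspec.1).1 hinf v hv
  rw [zero_sub, inner_neg_left, inner_sub_right, real_inner_self_eq_norm_sq] at this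
  linarith

variable [FiniteDimensional ℝ X]

/-! ### Clarke subgradients of locally Lipschitz functions -/

/-- The closure of the graph of the gradient of `f`, taken over the points of differentiability.
Its fiber over `x` consists of the limits of gradients that generate `∂f(x)`. -/
def gradientGraphClosure (f : X → ℝ) : Set (X × X) :=
  closure {p | DifferentiableAt ℝ f p.1 ∧ p.2 = gradient f p.1}

theorem clarkeSubdifferential_eq (f : X → ℝ) (x : X) :
    clarkeSubdifferential f x = closedConvexHull ℝ {v | (x, v) ∈ gradientGraphClosure f} := by
  unfold clarkeSubdifferential
  congr 1
  ext v
  simp only [Set.mem_ofPred_eq, gradientGraphClosure, mem_closure_iff_seq_limit]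
  constructor
  · rintro ⟨u, hu, hd, hv⟩
    exact ⟨fun r => (u r, gradient f (u r)), fun r => ⟨hd r, rfl⟩, hu.prodMk_nhds hv⟩
  · rintro ⟨p, hp, hlim⟩
    rw [nhds_prod_eq] at hlim
    refine ⟨fun r => (p r).1, hlim.fst, fun r => (hp r).1, ?_⟩
    simpa only [(hp _).2] using hlim.snd

variable {f : X → ℝ} {U : Set X} {K : NNReal}

theorem norm_gradient_le_of_lipschitzOn (hU : IsOpen U) (hf : LipschitzOnWith K f U) {x : X}
    (hx : x ∈ U) : ‖gradient f x‖ ≤ K := by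
  rw [gradient, LinearIsometryEquiv.norm_map]
  exact norm_fderiv_le_of_lipschitzOn ℝ (hU.mem_nhds hx) hf

theorem norm_le_of_mem_gradientGraphClosure (hU : IsOpen U) (hf : LipschitzOnWith K f U)
    {p : X × X} (hx : p.1 ∈ U) (hv : p ∈ gradientGraphClosure f) : ‖p.2‖ ≤ K := by
  have hopen : IsOpen (Prod.fst ⁻¹' U : Set (X × X)) := hU.preimage continuous_fst
  have hmem := hopen.inter_closure ⟨hx, hv⟩
  refine closure_minimal ?_ (isClosed_le (continuous_norm.comp continuous_snd) continuous_const)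
    hmem
  rintro q ⟨hq, -, hgrad⟩
  change ‖q.2‖ ≤ K
  rw [hgrad]
  exact norm_gradient_le_of_lipschitzOn hU hf hq

/-- Rademacher's theorem on an open set. -/
theorem ae_differentiableAt_of_lipschitzOn [MeasurableSpace X] [BorelSpace X] (hU : IsOpen U)
    (hf : LipschitzOnWith K f U) :
    ∀ᵐ y : X, y ∈ U → DifferentiableAt ℝ f y := by
  filter_upwards [hf.ae_differentiableWithinAt_of_mem (μ := MeasureTheory.volume)] with y hy hyU
  exact (hy hyU).differentiableAt (hU.mem_nhds hyU)

theorem isCompact_gradientGraphClosure_inter (hU : IsOpen U) (hf : LipschitzOnWith K f U)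
    {C : Set X} (hC : IsCompact C) (hCU : C ⊆ U) :
    IsCompact (gradientGraphClosure f ∩ Prod.fst ⁻¹' C) := by
  have := FiniteDimensional.proper_real X
  refine (hC.prod (isCompact_closedBall (0 : X) K)).of_isClosed_subset
    (isClosed_closure.inter (hC.isClosed.preimage continuous_fst)) ?_
  rintro p ⟨hp, hpC⟩
  exact ⟨hpC, by simpa using norm_le_of_mem_gradientGraphClosure hU hf (hCU hpC) hp⟩

theorem exists_mem_gradientGraphClosure (hU : IsOpen U) (hf : LipschitzOnWith K f U) {x : X}
    (hx : x ∈ U) : ∃ v, (x, v) ∈ gradientGraphClosure f := by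
  borelize X
  have := FiniteDimensional.proper_real X
  obtain ⟨r, hr, hrU⟩ := Metric.nhds_basis_closedBall.mem_iff.1 (hU.mem_nhds hx)
  have hdense := MeasureTheory.Measure.dense_of_ae (ae_differentiableAt_of_lipschitzOn hU hf)
  obtain ⟨u, hu, hux⟩ := mem_closure_iff_seq_limit.1 (hdense x)
  have hev : ∀ᶠ n in atTop, (u n, gradient f (u n)) ∈
      gradientGraphClosure f ∩ Prod.fst ⁻¹' Metric.closedBall x r := by
    filter_upwards [hux (Metric.closedBall_mem_nhds x hr)] with n hn
    exact ⟨subset_closure ⟨hu n (hrU hn), rfl⟩, hn⟩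
  obtain ⟨p, hp, φ, hφ, hlim⟩ := (isCompact_gradientGraphClosure_inter hU hf
    (isCompact_closedBall x r) hrU).tendsto_subseq' hev.frequently
  have h1 : Tendsto (fun n => u (φ n)) atTop (𝓝 p.1) := (continuous_fst.tendsto p).comp hlim
  have h2 : p.1 = x := tendsto_nhds_unique h1 (hux.comp hφ.tendsto_atTop)
  exact ⟨p.2, by rw [← h2]; exact hp.1⟩

theorem clarkeSubdifferential_eq_convexHull (hU : IsOpen U) (hf : LipschitzOnWith K f U) {x : X}
    (hx : x ∈ U) :
    clarkeSubdifferential f x = convexHull ℝ {v | (x, v) ∈ gradientGraphClosure f} := by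
  have hcomp := (isCompact_gradientGraphClosure_inter hU hf (isCompact_singleton (x := x))
    (by simpa using hx)).image continuous_snd
  have himage : Prod.snd '' (gradientGraphClosure f ∩ Prod.fst ⁻¹' {x}) =
      {v | (x, v) ∈ gradientGraphClosure f} := by
    ext v
    constructor
    · rintro ⟨⟨y, w⟩, ⟨hp, hy⟩, rfl⟩
      obtain rfl : y = x := hy
      exact hp
    · exact fun hv => ⟨(x, v), ⟨hv, rfl⟩, rfl⟩
  rw [himage] at hcomp
  rw [clarkeSubdifferential_eq, closedConvexHull_eq_closure_convexHull,
    hcomp.convexHull_of_finiteDimensional.isClosed.closure_eq]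

theorem goldsteinSubdifferential_eq (hU : IsOpen U) (hf : LipschitzOnWith K f U) {x : X} {ε : ℝ}
    (hx : Metric.closedBall x ε ⊆ U) :
    goldsteinSubdifferential f ε x =
      convexHull ℝ (Prod.snd '' (gradientGraphClosure f ∩ Prod.fst ⁻¹' Metric.closedBall x ε)) := by
  unfold goldsteinSubdifferential
  apply Set.Subset.antisymm
  · refine convexHull_min (Set.iUnion₂_subset fun y hy => ?_) (convex_convexHull ℝ _)
    rw [clarkeSubdifferential_eq_convexHull hU hf (hx hy)]
    exact convexHull_mono fun v hv => ⟨(y, v), ⟨hv, hy⟩, rfl⟩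
  · refine convexHull_mono ?_
    rintro _ ⟨⟨y, v⟩, ⟨hv, hy⟩, rfl⟩
    refine Set.mem_biUnion hy ?_
    rw [clarkeSubdifferential_eq_convexHull hU hf (hx hy)]
    exact subset_convexHull ℝ _ hv

theorem norm_le_of_mem_clarkeSubdifferential (hU : IsOpen U) (hf : LipschitzOnWith K f U) {x v : X}
    (hx : x ∈ U) (hv : v ∈ clarkeSubdifferential f x) : ‖v‖ ≤ K := by
  rw [clarkeSubdifferential_eq_convexHull hU hf hx] at hv
  have hsub : {v | (x, v) ∈ gradientGraphClosure f} ⊆ Metric.closedBall 0 K := fun w hw => by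
    simpa using norm_le_of_mem_gradientGraphClosure hU hf (p := (x, w)) hx hw
  simpa using convexHull_min hsub (convex_closedBall _ _) hv

/-- The variational characterization of the Goldstein subgradient. -/
theorem goldsteinSubgradient_spec (hU : IsOpen U) (hf : LipschitzOnWith K f U) {x : X} {ε : ℝ}
    (hε : 0 ≤ ε) (hx : Metric.closedBall x ε ⊆ U) :
    goldsteinSubgradient f ε x ∈ goldsteinSubdifferential f ε x ∧
      ∀ v ∈ goldsteinSubdifferential f ε x,
        ‖goldsteinSubgradient f ε x‖ ^ 2 ≤ inner ℝ (goldsteinSubgradient f ε x) v := by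
  have := FiniteDimensional.proper_real X
  have hxx := Metric.mem_closedBall_self (x := x) hε
  apply shortestVector_spec
  · obtain ⟨v, hv⟩ := exists_mem_gradientGraphClosure hU hf (hx hxx)
    refine ⟨v, subset_convexHull ℝ _ (Set.mem_biUnion hxx ?_)⟩
    rw [clarkeSubdifferential_eq_convexHull hU hf (hx hxx)]
    exact subset_convexHull ℝ _ hv
  · rw [goldsteinSubdifferential_eq hU hf hx]
    exact ((isCompact_gradientGraphClosure_inter hU hf (isCompact_closedBall x ε) hx).image
      continuous_snd).convexHull_of_finiteDimensional
  · exact convex_convexHull ℝ _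

/-! ### Descent along the Goldstein subgradient -/

/-- The function need not be differentiable anywhere on the segment itself. By Rademacher's theorem
and Fubini's theorem, it is differentiable almost everywhere on almost every parallel segment. -/
theorem sub_le_of_inner_gradient_le (hf : LipschitzOnWith K f U) {V : Set X} (hV : IsOpen V)
    (hVU : V ⊆ U) {x w : X} {c : ℝ} (hseg : segment ℝ x (x + w) ⊆ V)
    (hc : ∀ y ∈ V, DifferentiableAt ℝ f y → inner ℝ (gradient f y) w ≤ c) :
    f (x + w) - f x ≤ c := by
  borelize X
  have := FiniteDimensional.proper_real X
  obtain ⟨g, hg, hfg⟩ := hf.extend_real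
  have hmeas : MeasurableSet {y | DifferentiableAt ℝ g y} := measurableSet_of_differentiableAt ℝ g
  have hae := (MeasureTheory.ae_ae_add_linearMap_mem_iff
    ((LinearMap.id : ℝ →ₗ[ℝ] ℝ).smulRight w) MeasureTheory.volume MeasureTheory.volume
    hmeas).2 hg.ae_differentiableAt
  have hdense := MeasureTheory.Measure.dense_of_ae hae
  obtain ⟨u, hu, hux⟩ := mem_closure_iff_seq_limit.1 (hdense x)
  have hcompact : IsCompact (segment ℝ x (x + w)) := by
    rw [segment_eq_image_lineMap]
    exact isCompact_Icc.image AffineMap.lineMap_continuous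
  obtain ⟨δ, hδ, hthick⟩ := hcompact.exists_thickening_subset_open hV hseg
  have hg_le : ∀ᶠ n in atTop, g (u n + w) - g (u n) ≤ c := by
    filter_upwards [hux (Metric.ball_mem_nhds x hδ)] with n hn
    have hmem : ∀ t ∈ Set.Icc (0 : ℝ) 1, u n + t • w ∈ V := by
      intro t ht
      refine hthick (Metric.mem_thickening_iff.2 ⟨x + t • w, ?_, ?_⟩)
      · exact ⟨1 - t, t, by linarith [ht.2], ht.1, by ring, by module⟩
      · simpa [dist_eq_norm] using hn
    have hder : ∀ t ∈ Set.Icc (0 : ℝ) 1, DifferentiableAt ℝ g (u n + t • w) →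
        deriv (fun s : ℝ => g (u n + s • w)) t ≤ c := by
      intro t ht hd
      have heq : g =ᶠ[𝓝 (u n + t • w)] f := by
        filter_upwards [hV.mem_nhds (hmem t ht)] with y hy
        exact (hfg (hVU hy)).symm
      have hdf : DifferentiableAt ℝ f (u n + t • w) := heq.differentiableAt_iff.1 hd
      have hline : HasDerivAt (fun s : ℝ => u n + s • w) w t := by
        simpa using ((hasDerivAt_id t).smul_const w).const_add (u n)
      have h1 := hd.hasFDerivAt.comp_hasDerivAt t hline
      have h2 : fderiv ℝ g (u n + t • w) w = inner ℝ (gradient f (u n + t • w)) w := by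
        rw [heq.fderiv_eq, gradient, InnerProductSpace.toDual_symm_apply]
      have h3 : deriv (fun s : ℝ => g (u n + s • w)) t = fderiv ℝ g (u n + t • w) w := h1.deriv
      rw [h3, h2]
      exact hc _ (hmem t ht) hdf
    have hlip : LipschitzWith (K * ‖w‖₊) (fun s : ℝ => g (u n + s • w)) := by
      refine hg.comp (LipschitzWith.of_dist_le_mul fun s t => ?_)
      rw [dist_add_left, dist_eq_norm, ← sub_smul, norm_smul, mul_comm]
      rfl
    have hac := (hlip.lipschitzOnWith (s := Set.uIcc (0 : ℝ) 1)).absolutelyContinuousOnInterval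
    have hint := hac.integral_deriv_eq_sub
    have hle : ∫ t in (0 : ℝ)..1, deriv (fun s : ℝ => g (u n + s • w)) t ≤
        ∫ _ in (0 : ℝ)..1, c := by
      refine intervalIntegral.integral_mono_ae_restrict zero_le_one hac.intervalIntegrable_deriv
        intervalIntegrable_const ?_
      rw [Filter.EventuallyLE, MeasureTheory.ae_restrict_iff' measurableSet_Icc]
      filter_upwards [hu n] with t ht hmem
      exact hder t hmem ht
    rw [hint] at hle
    simpa using hle
  have hlim : Tendsto (fun n => g (u n + w) - g (u n)) atTop (𝓝 (g (x + w) - g x)) :=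
    ((hg.continuous.tendsto _).comp (hux.add_const w)).sub ((hg.continuous.tendsto _).comp hux)
  have hx : x ∈ U := hVU (hseg (left_mem_segment ℝ _ _))
  have hxw : x + w ∈ U := hVU (hseg (right_mem_segment ℝ _ _))
  rw [hfg hx, hfg hxw]
  exact le_of_tendsto hlim hg_le

/-- A one-sided form of Lebourg's mean value theorem. -/
theorem sub_le_of_inner_clarkeSubgradient_le (hU : IsOpen U) (hf : LipschitzOnWith K f U)
    {x w : X} {c : ℝ} (hseg : segment ℝ x (x + w) ⊆ U)
    (hc : ∀ y ∈ segment ℝ x (x + w), ∀ v ∈ clarkeSubdifferential f y, inner ℝ v w ≤ c) :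
    f (x + w) - f x ≤ c := by
  have := FiniteDimensional.proper_real X
  refine le_of_forall_gt_imp_ge_of_dense fun c' hcc' => ?_
  have hcompact : IsCompact (segment ℝ x (x + w)) := by
    rw [segment_eq_image_lineMap]
    exact isCompact_Icc.image AffineMap.lineMap_continuous
  obtain ⟨δ, hδ, hthick⟩ := hcompact.exists_cthickening_subset_open hU hseg
  -- The points near the segment carrying a limiting gradient that violates the relaxed bound form
  -- a compact set, which misses the segment.
  let B : Set X := Prod.fst '' ((gradientGraphClosure f ∩
    Prod.fst ⁻¹' Metric.cthickening δ (segment ℝ x (x + w))) ∩ {p | c' ≤ inner ℝ p.2 w})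
  have hB : IsClosed B := by
    refine (((isCompact_gradientGraphClosure_inter hU hf hcompact.cthickening hthick).inter_right
      ?_).image continuous_fst).isClosed
    exact isClosed_le continuous_const (continuous_snd.inner continuous_const)
  refine sub_le_of_inner_gradient_le hf
    (V := Metric.thickening δ (segment ℝ x (x + w)) \ B) (Metric.isOpen_thickening.sdiff hB)
    (fun y hy => hthick (Metric.thickening_subset_cthickening _ _ hy.1)) ?_ ?_
  · intro y hy
    refine ⟨Metric.self_subset_thickening hδ _ hy, ?_⟩
    rintro ⟨⟨y', v⟩, ⟨⟨hp, -⟩, hv⟩, rfl⟩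
    have := hc y' hy v (by
      rw [clarkeSubdifferential_eq]
      exact subset_closedConvexHull hp)
    exact absurd (hcc'.trans_le hv) this.not_gt
  · rintro y ⟨hy, hyB⟩ hd
    by_contra! hlt
    exact hyB ⟨(y, gradient f y), ⟨⟨subset_closure ⟨hd, rfl⟩,
      Metric.thickening_subset_cthickening _ _ hy⟩, hlt.le⟩, rfl⟩

theorem norm_goldsteinUpdate_sub_le {x : X} {ε : ℝ} (hε : 0 ≤ ε) :
    ‖goldsteinUpdate f ε x - x‖ ≤ ε := by
  rw [goldsteinUpdate, sub_sub_cancel_left, norm_neg, norm_smul, norm_div, norm_norm,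
    Real.norm_of_nonneg hε]
  rcases eq_or_ne ‖goldsteinSubgradient f ε x‖ 0 with h0 | h0
  · simpa [h0] using hε
  · rw [div_mul_cancel₀ _ h0]

theorem goldsteinUpdate_descent (hU : IsOpen U) (hf : LipschitzOnWith K f U) {x : X} {ε : ℝ}
    (hε : 0 ≤ ε) (hx : Metric.closedBall x ε ⊆ U) :
    f (goldsteinUpdate f ε x) ≤ f x - ε * ‖goldsteinSubgradient f ε x‖ := by
  obtain ⟨-, hspec⟩ := goldsteinSubgradient_spec hU hf hε hx
  have hball := norm_goldsteinUpdate_sub_le (f := f) (x := x) hε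
  set g := goldsteinSubgradient f ε x with hg
  have hupd : goldsteinUpdate f ε x = x + -((ε / ‖g‖) • g) := by
    rw [goldsteinUpdate, ← hg, sub_eq_add_neg]
  have hseg : segment ℝ x (x + -((ε / ‖g‖) • g)) ⊆ Metric.closedBall x ε := by
    rw [← hupd]
    refine (convex_closedBall x ε).segment_subset (Metric.mem_closedBall_self hε) ?_
    rwa [mem_closedBall_iff_norm]
  have := sub_le_of_inner_clarkeSubgradient_le hU hf (c := -(ε * ‖g‖)) (hseg.trans hx) (by
    intro y hy v hv
    have h1 := hspec v (subset_convexHull ℝ _ (Set.mem_biUnion (hseg hy) hv))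
    rw [inner_neg_right, inner_smul_right, real_inner_comm, neg_le_neg_iff]
    rcases eq_or_ne ‖g‖ 0 with h0 | h0
    · simp [h0]
    · calc ε * ‖g‖ = ε / ‖g‖ * ‖g‖ ^ 2 := by field_simp
        _ ≤ ε / ‖g‖ * inner ℝ g v := by gcongr)
  rw [hupd]
  linarith

end

/-! ### Straightening a manifold -/

section

variable {X : Type*} [NormedAddCommGroup X] [InnerProductSpace ℝ X]

/-- `e` is a `C²`-diffeomorphism around `xbar` that maps `M` locally onto the subspace `T`, sends
`xbar` to `0`, and has the identity as its derivative at `xbar`, so that `T` is the tangent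
space of `M` at `xbar`. -/
structure IsStraightening (e : OpenPartialHomeomorph X X) (T : Submodule ℝ X) (M : Set X)
    (xbar : X) : Prop where
  mem_source : xbar ∈ e.source
  map_base : e xbar = 0
  contDiffAt : ∀ x ∈ e.source, ContDiffAt ℝ 2 e x
  contDiffAt_symm : ∀ u ∈ e.target, ContDiffAt ℝ 2 e.symm u
  hasFDerivAt_symm : HasFDerivAt e.symm (ContinuousLinearMap.id ℝ X) 0
  mem_iff : ∀ x ∈ e.source, (x ∈ M ↔ e x ∈ T)

variable {M : Set X} {xbar : X} {e : OpenPartialHomeomorph X X} {T : Submodule ℝ X}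

namespace IsStraightening

theorem zero_mem_target (h : IsStraightening e T M xbar) : (0 : X) ∈ e.target :=
  h.map_base ▸ e.map_source h.mem_source

theorem symm_zero (h : IsStraightening e T M xbar) : e.symm 0 = xbar := by
  rw [← h.map_base, e.left_inv h.mem_source]

theorem base_mem (h : IsStraightening e T M xbar) : xbar ∈ M :=
  (h.mem_iff _ h.mem_source).2 (h.map_base ▸ T.zero_mem)

theorem tendsto_base (h : IsStraightening e T M xbar) : Tendsto e (𝓝 xbar) (𝓝 0) := by
  simpa only [ContinuousAt, h.map_base] using e.continuousAt h.mem_source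

theorem hasFDerivAt_symm_fderiv (h : IsStraightening e T M xbar) {u : X} (hu : u ∈ e.target) :
    HasFDerivAt e.symm (fderiv ℝ e.symm u) u :=
  ((h.contDiffAt_symm u hu).differentiableAt (by norm_num)).hasFDerivAt

theorem symm_mem (h : IsStraightening e T M xbar) {u : X} (hu : u ∈ e.target) (huT : u ∈ T) :
    e.symm u ∈ M :=
  (h.mem_iff _ (e.map_target hu)).2 ((e.right_inv hu).symm ▸ huT)

/-- `e.symm` is a small perturbation of the identity near `0`, in the strict sense. -/
theorem eventually_symm_sub (h : IsStraightening e T M xbar) {η : ℝ} (hη : 0 < η) :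
    ∀ᶠ p : X × X in 𝓝 (0, 0), ‖e.symm p.1 - e.symm p.2 - (p.1 - p.2)‖ ≤ η * ‖p.1 - p.2‖ := by
  have hstrict := (h.contDiffAt_symm 0 h.zero_mem_target).hasStrictFDerivAt' h.hasFDerivAt_symm
    (by norm_num)
  exact hstrict.isLittleO.def hη

theorem eventually_fderiv_symm_sub (h : IsStraightening e T M xbar) {η : ℝ} (hη : 0 < η) :
    ∀ᶠ u in 𝓝 (0 : X), ∀ w, ‖fderiv ℝ e.symm u w - w‖ ≤ η * ‖w‖ := by
  have hc : ContinuousAt (fderiv ℝ e.symm) 0 :=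
    ((h.contDiffAt_symm 0 h.zero_mem_target).fderiv_right (m := 1) (by norm_num)).continuousAt
  filter_upwards [hc.eventually (Metric.ball_mem_nhds _ hη)] with u hu w
  replace hu : dist (fderiv ℝ e.symm u) (fderiv ℝ e.symm 0) < η := hu
  rw [h.hasFDerivAt_symm.fderiv, dist_eq_norm] at hu
  exact (fderiv ℝ e.symm u - ContinuousLinearMap.id ℝ X).le_of_opNorm_le hu.le w

end IsStraightening

variable [FiniteDimensional ℝ X]

/-- If `A` is the derivative at `xbar` of the defining map `F` and `R` is a right inverse of `A`,
then `x ↦ (x - xbar) + R (F x - A (x - xbar))` straightens the zero set of `F` to the kernel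
of `A`. -/
theorem IsC2ManifoldAround.exists_straightening (hM : IsC2ManifoldAround M xbar) :
    ∃ e T, IsStraightening e T M xbar := by
  obtain ⟨hxM, k, F, hF, hsurj, hzero⟩ := hM
  set A := fderiv ℝ F xbar with hA
  obtain ⟨R, hR⟩ := A.exists_rightInverse_of_surjective (LinearMap.range_eq_top.2 hsurj)
  have hAR : ∀ z, A (R z) = z := fun z => congrArg (fun L => L z) hR
  let Φ : X → X := fun x => (x - xbar) + R (F x - A (x - xbar))
  have hsub : ContDiffAt ℝ 2 (fun x : X => x - xbar) xbar := contDiffAt_id.sub contDiffAt_const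
  have hΦ : ContDiffAt ℝ 2 Φ xbar := by
    refine hsub.add (R.contDiff.contDiffAt.comp xbar (hF.sub ?_))
    exact A.contDiff.contDiffAt.comp xbar hsub
  have hΦ' : HasFDerivAt Φ ((ContinuousLinearEquiv.refl ℝ X : X ≃L[ℝ] X) : X →L[ℝ] X) xbar := by
    have h1 : HasFDerivAt (fun x : X => x - xbar) (ContinuousLinearMap.id ℝ X) xbar :=
      (hasFDerivAt_id xbar).sub_const xbar
    have h2 : HasFDerivAt F A xbar := (hF.differentiableAt (by norm_num)).hasFDerivAt
    have h3 := h1.add (R.hasFDerivAt.comp xbar (h2.sub (A.hasFDerivAt.comp xbar h1)))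
    have h4 : ContinuousLinearMap.id ℝ X + R.comp (A - A.comp (ContinuousLinearMap.id ℝ X)) =
        ((ContinuousLinearEquiv.refl ℝ X : X ≃L[ℝ] X) : X →L[ℝ] X) := by
      ext v
      simp
    rw [h4] at h3
    exact h3
  have hAΦ : ∀ x, A (Φ x) = F x := fun x => by
    simp only [Φ, map_add, hAR, add_sub_cancel]
  have hn : (2 : WithTop ℕ∞) ≠ 0 := by norm_num
  have hninf : (2 : WithTop ℕ∞) ≠ ((⊤ : ℕ∞) : WithTop ℕ∞) := by decide
  let e₀ := hΦ.toOpenPartialHomeomorph Φ hΦ' hn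
  have he₀ : (e₀ : X → X) = Φ := rfl
  have hmem₀ : xbar ∈ e₀.source := hΦ.mem_toOpenPartialHomeomorph_source hΦ' hn
  have hF0 : F xbar = 0 := hzero.self_of_nhds.1 hxM
  have hΦ0 : Φ xbar = 0 := by simp [Φ, hF0]
  have hsymm : ContDiffAt ℝ 2 e₀.symm (e₀ xbar) := by
    refine e₀.contDiffAt_symm (f₀' := ContinuousLinearEquiv.refl ℝ X) (e₀.map_source hmem₀) ?_ ?_
    · rwa [e₀.left_inv hmem₀]
    · rwa [e₀.left_inv hmem₀]
  have hev : ∀ᶠ x in 𝓝 xbar, ContDiffAt ℝ 2 Φ x ∧ ContDiffAt ℝ 2 e₀.symm (e₀ x) ∧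
      (x ∈ M ↔ F x = 0) :=
    (hΦ.eventually hninf).and
      (((e₀.continuousAt hmem₀).eventually (hsymm.eventually hninf)).and hzero)
  obtain ⟨s, hs, hsopen, hxs⟩ := eventually_nhds_iff.1 hev
  refine ⟨e₀.restrOpen s hsopen, LinearMap.ker (A : X →ₗ[ℝ] EuclideanSpace ℝ (Fin k)),
    ⟨⟨hmem₀, hxs⟩, hΦ0, fun x hx => (hs x hx.2).1, ?_, ?_, ?_⟩⟩
  · intro u hu
    have hu' := (e₀.restrOpen s hsopen).map_target hu
    have hright := (e₀.restrOpen s hsopen).right_inv hu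
    have h2 := (hs _ hu'.2).2.1
    change e₀ (e₀.symm u) = u at hright
    change ContDiffAt ℝ 2 e₀.symm (e₀ (e₀.symm u)) at h2
    rwa [hright] at h2
  · change HasFDerivAt e₀.symm _ 0
    have h0 : e₀ xbar = 0 := hΦ0
    have ht : (0 : X) ∈ e₀.target := h0 ▸ e₀.map_source hmem₀
    have hs0 : e₀.symm 0 = xbar := by rw [← h0, e₀.left_inv hmem₀]
    exact e₀.hasFDerivAt_symm (f' := ContinuousLinearEquiv.refl ℝ X) ht (hs0 ▸ hΦ')
  · intro x hx
    rw [(hs x hx.2).2.2, ← hAΦ]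
    rfl

namespace IsStraightening

/-! ### Nearest points -/

theorem nearestPoint_spec (h : IsStraightening e T M xbar) : ∀ᶠ x in 𝓝 xbar,
    nearestPoint M x ∈ M ∧ dist x (nearestPoint M x) = Metric.infDist x M := by
  have := FiniteDimensional.proper_real X
  obtain ⟨r, hr, hrs⟩ := Metric.nhds_basis_closedBall.mem_iff.1
    (e.open_source.mem_nhds h.mem_source)
  have hset : M ∩ Metric.closedBall xbar r = Metric.closedBall xbar r ∩ e ⁻¹' T := by
    ext y
    constructor
    · exact fun hy => ⟨hy.2, (h.mem_iff y (hrs hy.2)).1 hy.1⟩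
    · exact fun hy => ⟨(h.mem_iff y (hrs hy.1)).2 hy.2, hy.1⟩
  have hcomp : IsCompact (M ∩ Metric.closedBall xbar r) := by
    rw [hset]
    exact (isCompact_closedBall xbar r).of_isClosed_subset
      ((e.continuousOn.mono hrs).preimage_isClosed_of_isClosed Metric.isClosed_closedBall
        T.closed_of_finiteDimensional) Set.inter_subset_left
  filter_upwards [Metric.ball_mem_nhds xbar (half_pos hr)] with x hx
  rw [Metric.mem_ball] at hx
  have hbase : xbar ∈ M ∩ Metric.closedBall xbar r :=
    ⟨h.base_mem, Metric.mem_closedBall_self hr.le⟩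
  obtain ⟨p, hp, hmin⟩ := hcomp.exists_isMinOn ⟨xbar, hbase⟩
    (f := fun y => dist x y) (by fun_prop)
  refine Classical.epsilon_spec (p := fun y => y ∈ M ∧ dist x y = Metric.infDist x M)
    ⟨p, hp.1, le_antisymm ?_ (Metric.infDist_le_dist_of_mem hp.1)⟩
  refine (Metric.le_infDist ⟨xbar, h.base_mem⟩).2 fun y hy => ?_
  by_cases hyr : y ∈ Metric.closedBall xbar r
  · exact hmin ⟨hy, hyr⟩
  · have h1 : dist x p ≤ dist x xbar := hmin hbase
    rw [Metric.mem_closedBall, not_le] at hyr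
    have h2 := dist_triangle y x xbar
    rw [dist_comm y x] at h2
    linarith

theorem tendsto_nearestPoint (h : IsStraightening e T M xbar) :
    Tendsto (nearestPoint M) (𝓝 xbar) (𝓝 xbar) := by
  rw [tendsto_iff_dist_tendsto_zero]
  have hlim : Tendsto (fun x => 2 * dist x xbar) (𝓝 xbar) (𝓝 0) := by
    have : Tendsto (fun x => 2 * dist x xbar) (𝓝 xbar) (𝓝 (2 * dist xbar xbar)) := by
      exact Continuous.tendsto (by fun_prop) xbar
    simpa using this
  refine squeeze_zero' (Eventually.of_forall fun _ => dist_nonneg) ?_ hlim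
  filter_upwards [h.nearestPoint_spec] with x hx
  have h1 : dist x (nearestPoint M x) ≤ dist x xbar := by
    rw [hx.2]; exact Metric.infDist_le_dist_of_mem h.base_mem
  have h2 := dist_triangle_left (nearestPoint M x) xbar x
  linarith

/-- The vector from the nearest point is normal to the manifold, by the first-order optimality
condition along the curves `s ↦ e.symm (e p + s • t)`. -/
theorem inner_sub_nearestPoint (h : IsStraightening e T M xbar) : ∀ᶠ x in 𝓝 xbar, ∀ t ∈ T,
    inner ℝ (x - nearestPoint M x) (fderiv ℝ e.symm (e (nearestPoint M x)) t) = 0 := by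
  filter_upwards [h.nearestPoint_spec,
    h.tendsto_nearestPoint.eventually (e.open_source.mem_nhds h.mem_source)] with x hx hsrc t ht
  set p := nearestPoint M x with hp
  have htgt := e.map_source hsrc
  have huT : e p ∈ T := (h.mem_iff p hsrc).1 hx.1
  have hline : HasDerivAt (fun s : ℝ => e p + s • t) t 0 := by
    simpa using ((hasDerivAt_id (0 : ℝ)).smul_const t).const_add (e p)
  have hψ : HasFDerivAt e.symm (fderiv ℝ e.symm (e p)) (e p + (0 : ℝ) • t) := by
    simpa using h.hasFDerivAt_symm_fderiv htgt
  have hcurve : HasDerivAt (fun s : ℝ => x - e.symm (e p + s • t))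
      (-(fderiv ℝ e.symm (e p) t)) 0 := (hψ.comp_hasDerivAt 0 hline).const_sub x
  have hsq := hcurve.norm_sq
  have hmin : IsLocalMin (fun s : ℝ => ‖x - e.symm (e p + s • t)‖ ^ 2) 0 := by
    have hev : ∀ᶠ s : ℝ in 𝓝 0, e p + s • t ∈ e.target :=
      hline.continuousAt.eventually (by simpa using e.open_target.mem_nhds htgt)
    filter_upwards [hev] with s hs
    have hmem := h.symm_mem hs (T.add_mem huT (T.smul_mem s ht))
    have hle := Metric.infDist_le_dist_of_mem (x := x) hmem
    rw [← hx.2, dist_eq_norm, dist_eq_norm] at hle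
    simp only [zero_smul, add_zero, e.left_inv hsrc]
    gcongr
  have h0 := hmin.hasDerivAt_eq_zero hsq
  simp only [zero_smul, add_zero, e.left_inv hsrc, inner_neg_right] at h0
  linarith

/-- The nearest-point map is Lipschitz up to a small multiple of the distances to the manifold.
Near `xbar`, nearest-point residuals are almost orthogonal to `T`, while differences of points of
`M` almost lie in `T`. -/
theorem norm_nearestPoint_sub_le (h : IsStraightening e T M xbar) {η : ℝ} (hη : 0 < η) :
    ∃ ρ > 0, ∀ x ∈ Metric.ball xbar ρ, ∀ z ∈ Metric.ball xbar ρ,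
      ‖nearestPoint M x - nearestPoint M z‖ ≤
        3 * ‖x - z‖ + η * (Metric.infDist x M + Metric.infDist z M) := by
  set κ := min (η / 3) (1 / 2) with hκ
  have hκ0 : 0 < κ := by positivity
  have hκ1 : κ ≤ 1 / 2 := min_le_right _ _
  have hκη : 3 * κ ≤ η := by linarith [min_le_left (η / 3) (1 / 2 : ℝ)]
  have htend : Tendsto (fun x => e (nearestPoint M x)) (𝓝 xbar) (𝓝 0) :=
    h.tendsto_base.comp h.tendsto_nearestPoint
  have hsrc := h.tendsto_nearestPoint.eventually (e.open_source.mem_nhds h.mem_source)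
  have hpair : ∀ᶠ q : X × X in 𝓝 (xbar, xbar),
      ‖e.symm (e (nearestPoint M q.1)) - e.symm (e (nearestPoint M q.2)) -
        (e (nearestPoint M q.1) - e (nearestPoint M q.2))‖ ≤
      κ * ‖e (nearestPoint M q.1) - e (nearestPoint M q.2)‖ := by
    have : Tendsto (fun q : X × X => (e (nearestPoint M q.1), e (nearestPoint M q.2)))
        (𝓝 (xbar, xbar)) (𝓝 (0, 0)) :=
      (htend.comp (continuous_fst.tendsto (xbar, xbar))).prodMk_nhds
        (htend.comp (continuous_snd.tendsto (xbar, xbar)))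
    exact this.eventually (h.eventually_symm_sub hκ0)
  obtain ⟨ρ₁, hρ₁, hball₁⟩ := Metric.eventually_nhds_iff_ball.1 hpair
  have hone := (h.nearestPoint_spec.and h.inner_sub_nearestPoint).and
    (hsrc.and (htend.eventually (h.eventually_fderiv_symm_sub hκ0)))
  obtain ⟨ρ₂, hρ₂, hball₂⟩ := Metric.eventually_nhds_iff_ball.1 hone
  refine ⟨min ρ₁ ρ₂, lt_min hρ₁ hρ₂, fun x hx z hz => ?_⟩
  obtain ⟨⟨⟨hxM, hxd⟩, hxn⟩, hxs, hxD⟩ := hball₂ x (Metric.ball_subset_ball (min_le_right _ _) hx)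
  obtain ⟨⟨⟨hzM, hzd⟩, hzn⟩, hzs, hzD⟩ := hball₂ z (Metric.ball_subset_ball (min_le_right _ _) hz)
  have hxz := hball₁ (x, z) (by
    rw [← ball_prod_same]
    exact ⟨Metric.ball_subset_ball (min_le_left _ _) hx,
      Metric.ball_subset_ball (min_le_left _ _) hz⟩)
  simp only [e.left_inv hxs, e.left_inv hzs] at hxz
  rw [dist_eq_norm] at hxd hzd
  set p := nearestPoint M x
  set q := nearestPoint M z
  set s := e p - e q with hs
  have hsT : s ∈ T := T.sub_mem ((h.mem_iff p hxs).1 hxM) ((h.mem_iff q hzs).1 hzM)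
  have hix : |inner ℝ (x - p) s| ≤ Metric.infDist x M * (κ * ‖s‖) := by
    have : inner ℝ (x - p) s = -inner ℝ (x - p) (fderiv ℝ e.symm (e p) s - s) := by
      rw [inner_sub_right _ _ s, hxn s hsT]; ring
    rw [this, abs_neg, ← hxd]
    exact (abs_real_inner_le_norm _ _).trans (by gcongr; exact hxD s)
  have hiz : |inner ℝ (z - q) s| ≤ Metric.infDist z M * (κ * ‖s‖) := by
    have : inner ℝ (z - q) s = -inner ℝ (z - q) (fderiv ℝ e.symm (e q) s - s) := by
      rw [inner_sub_right _ _ s, hzn s hsT]; ring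
    rw [this, abs_neg, ← hzd]
    exact (abs_real_inner_le_norm _ _).trans (by gcongr; exact hzD s)
  have hpq : (1 - κ) * ‖s‖ ^ 2 ≤ inner ℝ (p - q) s := by
    have h1 : inner ℝ (p - q) s = ‖s‖ ^ 2 + inner ℝ (p - q - s) s := by
      rw [inner_sub_left (p - q) s s, real_inner_self_eq_norm_sq]; ring
    have h2 : |inner ℝ (p - q - s) s| ≤ κ * ‖s‖ * ‖s‖ :=
      (abs_real_inner_le_norm _ _).trans (by gcongr)
    nlinarith [neg_abs_le (inner ℝ (p - q - s) s)]
  have hsum : inner ℝ (x - z) s = inner ℝ (x - p) s + inner ℝ (p - q) s - inner ℝ (z - q) s := by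
    rw [← inner_add_left, ← inner_sub_left]
    congr 1
    abel
  have hxzs : inner ℝ (x - z) s ≤ ‖x - z‖ * ‖s‖ := real_inner_le_norm _ _
  have hmain : (1 - κ) * ‖s‖ ≤
      ‖x - z‖ + κ * (Metric.infDist x M + Metric.infDist z M) := by
    rcases (norm_nonneg s).eq_or_lt with h0 | h0
    · rw [← h0, mul_zero]
      have := Metric.infDist_nonneg (x := x) (s := M)
      have := Metric.infDist_nonneg (x := z) (s := M)
      positivity
    · refine le_of_mul_le_mul_right ?_ h0
      nlinarith [neg_abs_le (inner ℝ (x - p) s), le_abs_self (inner ℝ (z - q) s)]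
  have hpqn : ‖p - q‖ ≤ (1 + κ) * ‖s‖ := by
    have := norm_add_le (p - q - s) s
    rw [sub_add_cancel] at this
    linarith
  have hd0 : 0 ≤ Metric.infDist x M + Metric.infDist z M :=
    add_nonneg Metric.infDist_nonneg Metric.infDist_nonneg
  have h3 : 3 * κ * (Metric.infDist x M + Metric.infDist z M) ≤
      η * (Metric.infDist x M + Metric.infDist z M) := by gcongr
  nlinarith [norm_nonneg s]

end IsStraightening

end

/-! ### The Riemannian gradient near a minimizer with quadratic growth -/

section

variable {X : Type*} [NormedAddCommGroup X] [InnerProductSpace ℝ X]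

/-- The second derivative at a minimizer of `k` on `T` with quadratic growth is positive definite
on `T`, and the first derivative along `T` is approximated by it. -/
theorem fderiv_bounds_of_quadratic_growth {k : X → ℝ} (hk : ContDiffAt ℝ 2 k 0)
    {T : Submodule ℝ X} {c : ℝ} (hc : 0 < c)
    (hgrow : ∀ᶠ u in 𝓝 (0 : X), u ∈ T → c * ‖u‖ ^ 2 ≤ k u - k 0) :
    ∃ Λ > 0, ∀ᶠ u in 𝓝 (0 : X), u ∈ T →
      c * ‖u‖ ^ 2 ≤ fderiv ℝ k u u ∧ ∀ t ∈ T, fderiv ℝ k u t ≤ Λ * ‖u‖ * ‖t‖ := by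
  have hzero : ∀ t ∈ T, fderiv ℝ k 0 t = 0 := by
    intro t ht
    have hline : HasDerivAt (fun s : ℝ => s • t) t 0 := by
      simpa using (hasDerivAt_id (0 : ℝ)).smul_const t
    have hk0 : HasFDerivAt k (fderiv ℝ k 0) ((0 : ℝ) • t) := by
      simpa using (hk.differentiableAt (by norm_num)).hasFDerivAt
    have hmin : IsLocalMin (fun s : ℝ => k (s • t)) 0 := by
      have hev : ∀ᶠ s : ℝ in 𝓝 0, s • t ∈ T → c * ‖s • t‖ ^ 2 ≤ k (s • t) - k 0 :=
        hline.continuousAt.eventually (by simpa using hgrow)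
      filter_upwards [hev] with s hs
      have h1 := hs (T.smul_mem s ht)
      have : 0 ≤ c * ‖s • t‖ ^ 2 := by positivity
      simp only [zero_smul]
      linarith
    exact hmin.hasDerivAt_eq_zero (hk0.comp_hasDerivAt 0 hline)
  have hD : DifferentiableAt ℝ (fderiv ℝ k) 0 :=
    (hk.fderiv_right (m := 1) (by norm_num)).differentiableAt (by norm_num)
  set B := fderiv ℝ (fderiv ℝ k) 0 with hB
  have happrox : ∀ᶠ u in 𝓝 (0 : X), ‖fderiv ℝ k u - fderiv ℝ k 0 - B u‖ ≤ c / 3 * ‖u‖ := by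
    simpa using hD.hasFDerivAt.isLittleO.def (c := c / 3) (by positivity)
  have hdiff : ∀ᶠ u in 𝓝 (0 : X), DifferentiableAt ℝ k u :=
    (hk.eventually (by decide)).mono fun u hu => hu.differentiableAt (by norm_num)
  obtain ⟨ρ, hρ, hball⟩ := Metric.eventually_nhds_iff_ball.1 (happrox.and hdiff)
  refine ⟨‖B‖ + c / 3, by positivity, ?_⟩
  filter_upwards [hgrow, Metric.ball_mem_nhds (0 : X) hρ] with u hgu hu huT
  have hDt : ∀ t ∈ T, |fderiv ℝ k u t - B u t| ≤ c / 3 * ‖u‖ * ‖t‖ := by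
    intro t ht
    have := (fderiv ℝ k u - fderiv ℝ k 0 - B u).le_of_opNorm_le (hball u hu).1 t
    simpa [hzero t ht] using this
  constructor
  · -- Taylor's formula along the segment from `0` to `u`.
    let φ : ℝ → ℝ := fun s => k (s • u) - s ^ 2 / 2 * B u u
    have hseg : ∀ s ∈ Set.Icc (0 : ℝ) 1, s • u ∈ Metric.ball (0 : X) ρ := by
      intro s hs
      rw [mem_ball_zero_iff] at hu ⊢
      rw [norm_smul, Real.norm_of_nonneg hs.1]
      nlinarith [norm_nonneg u, hs.2]
    have hφ : ∀ s ∈ Set.Icc (0 : ℝ) 1,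
        HasDerivWithinAt φ (fderiv ℝ k (s • u) u - s * B u u) (Set.Icc 0 1) s := by
      intro s hs
      have hline : HasDerivAt (fun r : ℝ => r • u) u s := by
        simpa using (hasDerivAt_id s).smul_const u
      have h1 := (hball _ (hseg s hs)).2.hasFDerivAt.comp_hasDerivAt s hline
      have h2 : HasDerivAt (fun r : ℝ => r ^ 2 / 2 * B u u) (s * B u u) s := by
        have := ((hasDerivAt_pow 2 s).div_const 2).mul_const (B u u)
        simpa using this
      exact (h1.sub h2).hasDerivWithinAt
    have hbound : ∀ s ∈ Set.Ico (0 : ℝ) 1,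
        ‖fderiv ℝ k (s • u) u - s * B u u‖ ≤ c / 3 * ‖u‖ * ‖u‖ := by
      intro s hs
      have h1 := (fderiv ℝ k (s • u) - fderiv ℝ k 0 - B (s • u)).le_of_opNorm_le
        (hball _ (hseg s (Set.Ico_subset_Icc_self hs))).1 u
      have h2 : (fderiv ℝ k (s • u) - fderiv ℝ k 0 - B (s • u)) u =
          fderiv ℝ k (s • u) u - s * B u u := by
        simp [hzero u huT]
      rw [h2] at h1
      refine h1.trans ?_
      rw [norm_smul, Real.norm_of_nonneg hs.1]
      have : s * ‖u‖ ≤ ‖u‖ := mul_le_of_le_one_left (norm_nonneg u) hs.2.le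
      gcongr
    have htaylor := norm_image_sub_le_of_norm_deriv_le_segment_01' hφ hbound
    have h3 : φ 1 - φ 0 = k u - k 0 - B u u / 2 := by
      simp only [φ, one_smul, zero_smul]; ring
    rw [h3, Real.norm_eq_abs] at htaylor
    have h4 := hDt u huT
    have h5 := hgu huT
    nlinarith [le_abs_self (k u - k 0 - B u u / 2), neg_abs_le (fderiv ℝ k u u - B u u)]
  · intro t ht
    have h1 : B u t ≤ ‖B‖ * ‖u‖ * ‖t‖ :=
      (le_abs_self _).trans (B.le_opNorm₂ u t)
    have h2 := hDt t ht
    nlinarith [le_abs_self (fderiv ℝ k u t - B u t)]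

variable [FiniteDimensional ℝ X] {M : Set X} {xbar : X}

namespace IsStraightening

variable {e : OpenPartialHomeomorph X X} {T : Submodule ℝ X}

theorem tangentSpaceAt_eq (h : IsStraightening e T M xbar) {y : X} (hy : y ∈ e.source)
    (hyM : y ∈ M) :
    tangentSpaceAt M y = T.map (fderiv ℝ e.symm (e y) : X →ₗ[ℝ] X) := by
  have hu := e.map_source hy
  have huT : e y ∈ T := (h.mem_iff y hy).1 hyM
  have hψ := h.hasFDerivAt_symm_fderiv hu
  have hφ : HasFDerivAt e (fderiv ℝ e y) y :=
    ((h.contDiffAt y hy).differentiableAt (by norm_num)).hasFDerivAt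
  have hinv : ∀ v, fderiv ℝ e.symm (e y) (fderiv ℝ e y v) = v := by
    intro v
    have hcomp := hψ.comp y hφ
    have hid : HasFDerivAt (e.symm ∘ e) (ContinuousLinearMap.id ℝ X) y :=
      (hasFDerivAt_id y).congr_of_eventuallyEq (e.eventually_left_inverse hy)
    exact congrArg (fun L : X →L[ℝ] X => L v) (hcomp.unique hid)
  rw [tangentSpaceAt]
  apply le_antisymm
  · rw [Submodule.span_le]
    intro v hv
    refine ⟨fderiv ℝ e y v, ?_, hinv v⟩
    rw [← tangentConeAt_inter_nhds (e.open_source.mem_nhds hy)] at hv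
    have hmaps := (hφ.hasFDerivWithinAt (s := M ∩ e.source)).mapsTo_tangent_cone hv
    obtain ⟨ι, l, hl, c, d, -, hd, hlim⟩ := exists_fun_of_mem_tangentConeAt hmaps
    refine T.closed_of_finiteDimensional.mem_of_tendsto hlim ?_
    filter_upwards [hd] with n hn
    obtain ⟨z, hz, hzn⟩ := hn
    have hzT : e y + d n ∈ T := hzn ▸ (h.mem_iff z hz.2).1 hz.1
    exact T.smul_mem _ ((T.add_mem_iff_right huT).1 hzT)
  · rintro _ ⟨t, ht, rfl⟩
    refine Submodule.subset_span ?_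
    have hcone : t ∈ tangentConeAt ℝ ((T : Set X) ∩ e.target) (e y) := by
      rw [tangentConeAt_inter_nhds (e.open_target.mem_nhds hu)]
      have hs : segment ℝ (e y) (e y + t) ⊆ (T : Set X) :=
        T.convex.segment_subset huT (T.add_mem huT ht)
      simpa using mem_tangentConeAt_of_segment_subset hs
    have hmaps := (hψ.hasFDerivWithinAt (s := (T : Set X) ∩ e.target)).mapsTo_tangent_cone hcone
    rw [e.left_inv hy] at hmaps
    refine tangentConeAt_mono ?_ hmaps
    rintro _ ⟨w, ⟨hwT, hw⟩, rfl⟩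
    exact h.symm_mem hw hwT

/-- A linear function with a normal gradient is stationary along the manifold: on `M`, every point
`z` equals `e.symm` of the projection of `e z` to `T`. -/
theorem hasFDerivWithinAt_inner_normal (h : IsStraightening e T M xbar) {y n : X}
    (hy : y ∈ e.source) (hyM : y ∈ M) (hn : n ∈ (tangentSpaceAt M y)ᗮ) :
    HasFDerivWithinAt (fun z => inner ℝ n z) (0 : X →L[ℝ] ℝ) M y := by
  have hu := e.map_source hy
  have huT : e y ∈ T := (h.mem_iff y hy).1 hyM
  have hproj : T.starProjection (e y) = e y := Submodule.starProjection_eq_self_iff.2 huT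
  have hψ : HasFDerivAt e.symm (fderiv ℝ e.symm (e y)) (T.starProjection (e y)) := by
    rw [hproj]; exact h.hasFDerivAt_symm_fderiv hu
  have hφ : HasFDerivAt e (fderiv ℝ e y) y :=
    ((h.contDiffAt y hy).differentiableAt (by norm_num)).hasFDerivAt
  have hchain := (innerSL ℝ n).hasFDerivAt.comp y
    (hψ.comp y (T.starProjection.hasFDerivAt.comp y hφ))
  have hzero : (innerSL ℝ n).comp ((fderiv ℝ e.symm (e y)).comp
      (T.starProjection.comp (fderiv ℝ e y))) = 0 := by
    ext v
    refine (Submodule.mem_orthogonal' _ _).1 hn _ ?_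
    rw [h.tangentSpaceAt_eq hy hyM]
    exact ⟨_, Submodule.starProjection_apply_mem _ _, rfl⟩
  rw [hzero] at hchain
  have heq : ∀ z ∈ e.source, z ∈ M → inner ℝ n z = inner ℝ n (e.symm (T.starProjection (e z))) := by
    intro z hz hzM
    rw [Submodule.starProjection_eq_self_iff.2 ((h.mem_iff z hz).1 hzM), e.left_inv hz]
  refine hchain.hasFDerivWithinAt.congr_of_eventuallyEq ?_ (heq y hy hyM)
  filter_upwards [self_mem_nhdsWithin, mem_nhdsWithin_of_mem_nhds (e.open_source.mem_nhds hy)]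
    with z hzM hz using heq z hz hzM

/-- The Riemannian gradient exists: it is the projection to the tangent space of the gradient of
a smooth extension. -/
theorem riemannianGradient_spec (h : IsStraightening e T M xbar) {f k : X → ℝ} {y : X}
    (hy : y ∈ e.source) (hyM : y ∈ M) (hk : DifferentiableAt ℝ k y)
    (hfk : ∀ᶠ x in 𝓝 y, x ∈ M → f x = k x) :
    riemannianGradient f M y ∈ tangentSpaceAt M y ∧
      HasGradientWithinAt f (riemannianGradient f M y) M y := by
  set v := (tangentSpaceAt M y).starProjection (gradient k y) with hv
  refine Classical.epsilon_spec
    (p := fun v => v ∈ tangentSpaceAt M y ∧ HasGradientWithinAt f v M y)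
    ⟨v, Submodule.starProjection_apply_mem _ _, ?_⟩
  have hnormal := h.hasFDerivWithinAt_inner_normal hy hyM
    (Submodule.sub_starProjection_mem_orthogonal (K := tangentSpaceAt M y) (gradient k y))
  have hk' := hk.hasGradientAt.hasFDerivAt.hasFDerivWithinAt (s := M)
  have hlin : HasFDerivWithinAt
      (fun z => inner ℝ (gradient k y - (tangentSpaceAt M y).starProjection (gradient k y)) z)
      (InnerProductSpace.toDual ℝ X (gradient k y - v)) M y :=
    (InnerProductSpace.toDual ℝ X (gradient k y - v)).hasFDerivAt.hasFDerivWithinAt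
  have hsum := (hk'.sub hlin).add hnormal
  rw [hasGradientWithinAt_iff_hasFDerivWithinAt]
  have hfun : ∀ z, ((k - fun z => inner ℝ (gradient k y -
      (tangentSpaceAt M y).starProjection (gradient k y)) z) + fun z => inner ℝ (gradient k y -
      (tangentSpaceAt M y).starProjection (gradient k y)) z) z = k z := fun z => by simp
  have hder : InnerProductSpace.toDual ℝ X (gradient k y) -
      InnerProductSpace.toDual ℝ X (gradient k y - v) + 0 = InnerProductSpace.toDual ℝ X v := by
    rw [map_sub]; abel
  rw [hder] at hsum
  refine hsum.congr_of_eventuallyEq ?_ ?_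
  · filter_upwards [self_mem_nhdsWithin, mem_nhdsWithin_of_mem_nhds hfk] with z hzM hz
    rw [hfun, hz hzM]
  · rw [hfun, hfk.self_of_nhds hyM]

/-- In the straightened coordinates, the Riemannian gradient represents the derivative along `T`
of the composition of the smooth extension with `e.symm`. -/
theorem inner_riemannianGradient (h : IsStraightening e T M xbar) {f k : X → ℝ} {y : X}
    (hy : y ∈ e.source) (hyM : y ∈ M) (hk : DifferentiableAt ℝ k y)
    (hfk : ∀ᶠ x in 𝓝 y, x ∈ M → f x = k x) {t : X} (ht : t ∈ T) :
    inner ℝ (riemannianGradient f M y) (fderiv ℝ e.symm (e y) t) =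
      fderiv ℝ (k ∘ e.symm) (e y) t := by
  have hu := e.map_source hy
  have huT : e y ∈ T := (h.mem_iff y hy).1 hyM
  have hψ := h.hasFDerivAt_symm_fderiv hu
  have hkψ : HasFDerivAt k (fderiv ℝ k y) (e.symm (e y)) := by
    rw [e.left_inv hy]; exact hk.hasFDerivAt
  rw [(hkψ.comp (e y) hψ).fderiv]
  have hline : HasDerivAt (fun s : ℝ => e y + s • t) t 0 := by
    simpa using ((hasDerivAt_id (0 : ℝ)).smul_const t).const_add (e y)
  have hψ0 : HasFDerivAt e.symm (fderiv ℝ e.symm (e y)) (e y + (0 : ℝ) • t) := by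
    simpa using hψ
  have hcurve := hψ0.comp_hasDerivAt 0 hline
  have hbase : e.symm (e y + (0 : ℝ) • t) = y := by simp [e.left_inv hy]
  have hev : ∀ᶠ s : ℝ in 𝓝 0, e.symm (e y + s • t) ∈ M := by
    have : ∀ᶠ s : ℝ in 𝓝 0, e y + s • t ∈ e.target :=
      hline.continuousAt.eventually (by simpa using e.open_target.mem_nhds hu)
    filter_upwards [this] with s hs
    exact h.symm_mem hs (T.add_mem huT (T.smul_mem s ht))
  have hgrad := (h.riemannianGradient_spec hy hyM hk hfk).2.hasFDerivWithinAt
  -- Both functions are differentiated along the curve `s ↦ e.symm (e y + s • t)` in `M`.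
  have h1 : HasDerivAt (f ∘ fun s : ℝ => e.symm (e y + s • t))
      (inner ℝ (riemannianGradient f M y) (fderiv ℝ e.symm (e y) t)) 0 := by
    have := HasFDerivWithinAt.comp_hasDerivWithinAt (t := M)
      (s := {s : ℝ | e.symm (e y + s • t) ∈ M}) (0 : ℝ) (l := f)
      (f := fun s : ℝ => e.symm (e y + s • t)) (by rw [hbase]; exact hgrad)
      hcurve.hasDerivWithinAt (fun s hs => hs)
    exact this.hasDerivAt hev
  have h2 : HasDerivAt (k ∘ fun s : ℝ => e.symm (e y + s • t))
      (fderiv ℝ k y (fderiv ℝ e.symm (e y) t)) 0 := by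
    refine HasFDerivAt.comp_hasDerivAt (0 : ℝ) ?_ hcurve
    rw [hbase]
    exact hk.hasFDerivAt
  have heq : (f ∘ fun s : ℝ => e.symm (e y + s • t)) =ᶠ[𝓝 0]
      (k ∘ fun s : ℝ => e.symm (e y + s • t)) := by
    have htend : Tendsto (fun s : ℝ => e.symm (e y + s • t)) (𝓝 0) (𝓝 y) := by
      have := hcurve.continuousAt.tendsto
      simp only [Function.comp_apply, hbase] at this
      exact this
    filter_upwards [hev, htend.eventually hfk] with s hs hs'
    exact hs' hs
  exact h1.unique (h2.congr_of_eventuallyEq heq)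

/-- The Riemannian gradient makes an angle with the outward radial direction that is bounded away
from a right angle. -/
theorem exists_inner_riemannianGradient_ge (h : IsStraightening e T M xbar) {f : X → ℝ}
    (hf : GrowsQuadratically f xbar) (hC2 : RestrictionIsC2Around f M xbar) :
    ∃ κ > 0, ∀ᶠ y in 𝓝 xbar, y ∈ M →
      κ * (‖riemannianGradient f M y‖ * ‖y - xbar‖) ≤
        inner ℝ (riemannianGradient f M y) (y - xbar) := by
  obtain ⟨δ, hδ, hgrow⟩ := hf
  obtain ⟨k, hk, hfk⟩ := hC2
  have hsymm := (h.contDiffAt_symm 0 h.zero_mem_target)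
  have hkψ : ContDiffAt ℝ 2 (k ∘ e.symm) 0 := by
    refine ContDiffAt.comp 0 ?_ hsymm
    rwa [h.symm_zero]
  have htend : Tendsto e.symm (𝓝 0) (𝓝 xbar) := by
    simpa only [ContinuousAt, h.symm_zero] using hsymm.continuousAt
  have hpert : ∀ η > 0, ∀ᶠ u in 𝓝 (0 : X), ‖e.symm u - xbar - u‖ ≤ η * ‖u‖ := by
    intro η hη
    have hcont : Tendsto (fun u : X => (u, (0 : X))) (𝓝 0) (𝓝 (0, 0)) :=
      tendsto_id.prodMk_nhds tendsto_const_nhds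
    filter_upwards [hcont.eventually (h.eventually_symm_sub hη)] with u hu
    simpa [h.symm_zero] using hu
  have hgrowk : ∀ᶠ u in 𝓝 (0 : X), u ∈ T →
      δ / 8 * ‖u‖ ^ 2 ≤ (k ∘ e.symm) u - (k ∘ e.symm) 0 := by
    filter_upwards [htend.eventually (hgrow.and hfk), hpert (1 / 2) (by norm_num),
      e.open_target.mem_nhds h.zero_mem_target] with u hu hu' hut huT
    have hbase := hfk.self_of_nhds h.base_mem
    have h1 : 1 / 2 * ‖u‖ ≤ ‖e.symm u - xbar‖ := by
      have := norm_sub_norm_le u (u - (e.symm u - xbar))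
      rw [sub_sub_cancel, norm_sub_rev] at this
      linarith
    have h2 : (1 / 2 * ‖u‖) ^ 2 ≤ ‖e.symm u - xbar‖ ^ 2 := by gcongr
    have h3 := hu.2 (h.symm_mem hut huT)
    simp only [Function.comp_apply, h.symm_zero]
    rw [← h3, ← hbase]
    refine le_trans ?_ hu.1
    nlinarith
  obtain ⟨Λ, hΛ, hder⟩ := fderiv_bounds_of_quadratic_growth hkψ (by positivity) hgrowk
  set c := δ / 8 with hc
  have hc0 : 0 < c := by positivity
  set η := min (1 / 2) (c / (8 * Λ)) with hη
  have hη0 : 0 < η := by positivity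
  have hη1 : η ≤ 1 / 2 := min_le_left _ _
  have hη2 : 8 * Λ * η ≤ c := by
    calc 8 * Λ * η ≤ 8 * Λ * (c / (8 * Λ)) := by gcongr; exact min_le_right _ _
      _ = c := by field_simp
  refine ⟨c / (8 * Λ), by positivity, ?_⟩
  have hkdiff : ∀ᶠ y in 𝓝 xbar, DifferentiableAt ℝ k y :=
    (hk.eventually (by decide)).mono fun y hy => hy.differentiableAt (by norm_num)
  filter_upwards [h.tendsto_base.eventually (hder.and ((hpert η hη0).and
    (h.eventually_fderiv_symm_sub hη0))), e.open_source.mem_nhds h.mem_source, hkdiff,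
    hfk.eventually_nhds] with y hu hy hky hfky hyM
  obtain ⟨hu1, hu2, hu3⟩ := hu
  have huT : e y ∈ T := (h.mem_iff y hy).1 hyM
  obtain ⟨hu4, hu5⟩ := hu1 huT
  have hinner := fun t ht => h.inner_riemannianGradient hy hyM hky hfky (t := t) ht
  have htan := (h.riemannianGradient_spec hy hyM hky hfky).1
  rw [h.tangentSpaceAt_eq hy hyM] at htan
  rw [e.left_inv hy] at hu2
  set v := riemannianGradient f M y
  set u := e y
  obtain ⟨w, hwT, hw⟩ := htan
  change fderiv ℝ e.symm u w = v at hw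
  have hwv : ‖w‖ ≤ 2 * ‖v‖ := by
    have h1 := hu3 w
    rw [hw] at h1
    have h2 := norm_sub_norm_le w (w - v)
    rw [sub_sub_cancel, norm_sub_rev] at h2
    nlinarith [norm_nonneg w]
  have hv : ‖v‖ ≤ 2 * Λ * ‖u‖ := by
    have h1 := hinner w hwT
    rw [hw, real_inner_self_eq_norm_sq] at h1
    have h2 := hu5 w hwT
    rcases (norm_nonneg v).eq_or_lt with h0 | h0
    · rw [← h0]; positivity
    · refine le_of_mul_le_mul_right ?_ h0
      have : Λ * ‖u‖ * ‖w‖ ≤ Λ * ‖u‖ * (2 * ‖v‖) := by gcongr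
      nlinarith
  have hyu : ‖y - xbar‖ ≤ 2 * ‖u‖ := by
    have := norm_add_le (y - xbar - u) u
    rw [sub_add_cancel] at this
    nlinarith [norm_nonneg u]
  have herr : ‖y - xbar - fderiv ℝ e.symm u u‖ ≤ 2 * η * ‖u‖ := by
    have h1 := hu3 u
    rw [norm_sub_rev] at h1
    have h2 := norm_add_le (y - xbar - u) (u - fderiv ℝ e.symm u u)
    rw [sub_add_sub_cancel] at h2
    linarith
  have hmain : c * ‖u‖ ^ 2 - ‖v‖ * (2 * η * ‖u‖) ≤ inner ℝ v (y - xbar) := by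
    have h1 : inner ℝ v (y - xbar) =
        fderiv ℝ (k ∘ e.symm) u u + inner ℝ v (y - xbar - fderiv ℝ e.symm u u) := by
      rw [← hinner u huT, ← inner_add_right]
      congr 1
      abel
    have h2 : |inner ℝ v (y - xbar - fderiv ℝ e.symm u u)| ≤ ‖v‖ * (2 * η * ‖u‖) :=
      (abs_real_inner_le_norm _ _).trans (by gcongr)
    rw [h1]
    linarith [neg_abs_le (inner ℝ v (y - xbar - fderiv ℝ e.symm u u))]
  have hprod : ‖v‖ * ‖y - xbar‖ ≤ 2 * Λ * ‖u‖ * (2 * ‖u‖) := by gcongr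
  calc c / (8 * Λ) * (‖v‖ * ‖y - xbar‖) ≤ c / (8 * Λ) * (2 * Λ * ‖u‖ * (2 * ‖u‖)) := by gcongr
    _ = c / 2 * ‖u‖ ^ 2 := by field_simp; ring
    _ ≤ c * ‖u‖ ^ 2 - 2 * Λ * ‖u‖ * (2 * η * ‖u‖) := by nlinarith [sq_nonneg ‖u‖]
    _ ≤ c * ‖u‖ ^ 2 - ‖v‖ * (2 * η * ‖u‖) := by gcongr
    _ ≤ _ := hmain

end IsStraightening

end

/-! ### The Goldstein property -/

section

variable {X : Type*} [NormedAddCommGroup X] [InnerProductSpace ℝ X]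

/-- Turning a vector by a small angle changes the cosine of its angle to `y` by at most as much. -/
theorem half_mul_norm_mul_norm_le_inner_of_angle_lt {g w y : X} {κ : ℝ} (hg : g ≠ 0) (hw : w ≠ 0)
    (hangle : InnerProductGeometry.angle g w < κ / 2)
    (hwy : κ * (‖w‖ * ‖y‖) ≤ inner ℝ w y) : κ / 2 * (‖g‖ * ‖y‖) ≤ inner ℝ g y := by
  have hg0 : 0 < ‖g‖ := norm_pos_iff.2 hg
  have hw0 : 0 < ‖w‖ := norm_pos_iff.2 hw
  have hα := InnerProductGeometry.angle_nonneg g w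
  have hdiff : ‖(1 / ‖g‖) • g - (1 / ‖w‖) • w‖ ≤ κ / 2 := by
    refine abs_le_of_sq_le_sq' ?_ (hα.trans hangle.le) |>.2
    have hcos := Real.one_sub_sq_div_two_le_cos (x := InnerProductGeometry.angle g w)
    rw [InnerProductGeometry.cos_angle] at hcos
    rw [norm_sub_sq_real, norm_smul, norm_smul, inner_smul_left, inner_smul_right, norm_div,
      norm_div, norm_one, norm_norm, norm_norm, one_div_mul_cancel hg0.ne',
      one_div_mul_cancel hw0.ne']
    have heq : (starRingEnd ℝ) (1 / ‖g‖) * (1 / ‖w‖ * inner ℝ g w) =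
        inner ℝ g w / (‖g‖ * ‖w‖) := by
      rw [conj_trivial]; field_simp
    rw [heq]
    nlinarith
  have hunit : κ / 2 * ‖y‖ ≤ inner ℝ ((1 / ‖g‖) • g) y := by
    have h1 : inner ℝ ((1 / ‖g‖) • g) y =
        inner ℝ ((1 / ‖w‖) • w) y + inner ℝ ((1 / ‖g‖) • g - (1 / ‖w‖) • w) y := by
      rw [← inner_add_left]; congr 1; abel
    have h2 : |inner ℝ ((1 / ‖g‖) • g - (1 / ‖w‖) • w) y| ≤ κ / 2 * ‖y‖ :=
      (abs_real_inner_le_norm _ _).trans (by gcongr)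
    have h3 : κ * ‖y‖ ≤ inner ℝ ((1 / ‖w‖) • w) y := by
      rw [inner_smul_left, conj_trivial, one_div, ← div_eq_inv_mul, le_div_iff₀ hw0]
      linarith
    linarith [neg_abs_le (inner ℝ ((1 / ‖g‖) • g - (1 / ‖w‖) • w) y)]
  rw [inner_smul_left, conj_trivial, one_div, ← div_eq_inv_mul, le_div_iff₀ hg0] at hunit
  linarith

/-- A short step against a vector that points away from the origin, as seen from a nearby
point `y`, contracts the norm. -/
theorem norm_sub_smul_sq_le {x y g : X} {κ C β ε : ℝ} (hκ : 0 < κ) (hκ1 : κ ≤ 1) (hC : 0 ≤ C)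
    (hg : g ≠ 0) (hgy : κ / 2 * (‖g‖ * ‖y‖) ≤ inner ℝ g y) (hε : 0 ≤ ε) (hεβ : ε ≤ β * ‖x‖)
    (hβ : 8 * C * β ≤ κ) (hβκ : 4 * β ≤ κ) (hxy : ‖x - y‖ ≤ C * ε) :
    ‖x - (ε / ‖g‖) • g‖ ^ 2 ≤ ‖x‖ ^ 2 - κ / 4 * ε * ‖x‖ := by
  have hg0 : 0 < ‖g‖ := norm_pos_iff.2 hg
  have hxn := norm_nonneg x
  have hCε : C * ε ≤ C * (β * ‖x‖) := by gcongr
  have hlower : κ / 4 * ‖x‖ * ‖g‖ ≤ inner ℝ g x := by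
    have h1 : inner ℝ g x = inner ℝ g y + inner ℝ g (x - y) := by
      rw [← inner_add_right]; congr 1; abel
    have h2 : |inner ℝ g (x - y)| ≤ ‖g‖ * (C * ε) :=
      (abs_real_inner_le_norm _ _).trans (by gcongr)
    have h3 : ‖x‖ - C * ε ≤ ‖y‖ := by
      linarith [norm_sub_norm_le x y]
    have h4 : κ / 2 * (‖g‖ * (‖x‖ - C * ε)) ≤ κ / 2 * (‖g‖ * ‖y‖) := by gcongr
    have h5 : κ / 2 * (C * ε) ≤ 1 * (C * ε) := by gcongr; linarith
    have h6 : 8 * C * β * ‖x‖ ≤ κ * ‖x‖ := by gcongr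
    have h7 : κ / 4 * ‖x‖ ≤ κ / 2 * (‖x‖ - C * ε) - C * ε := by linarith
    have h8 := mul_le_mul_of_nonneg_left h7 hg0.le
    linarith [neg_abs_le (inner ℝ g (x - y))]
  have hstep : ‖(ε / ‖g‖) • g‖ = ε := by
    rw [norm_smul, norm_div, norm_norm, Real.norm_of_nonneg hε, div_mul_cancel₀ _ hg0.ne']
  rw [norm_sub_sq_real, hstep, inner_smul_right, real_inner_comm]
  have h1 : ε * (κ / 4 * ‖x‖) ≤ ε / ‖g‖ * inner ℝ g x := by
    calc ε * (κ / 4 * ‖x‖) = ε / ‖g‖ * (κ / 4 * ‖x‖ * ‖g‖) := by field_simp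
      _ ≤ _ := by gcongr
  have h2 : ε * ε ≤ ε * (κ / 4 * ‖x‖) := by
    refine mul_le_mul_of_nonneg_left (hεβ.trans ?_) hε
    gcongr
    linarith
  nlinarith

variable [FiniteDimensional ℝ X] {f : X → ℝ} {M : Set X} {xbar : X}

/-- Far from the manifold relative to the radius `ε`, the aiming condition at the points of the
ball around `x` is inherited by `x` itself, and bounds Goldstein subgradients from below. -/
theorem exists_le_norm_goldsteinSubgradient_of_lt_infDist (hM : IsC2ManifoldAround M xbar)
    (hf : LocallyLipschitz f) (haim : AimingCondition f M xbar) :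
    ∃ C > 0, ∃ c > 0, ∀ᶠ x in 𝓝 xbar, ∀ ε, 0 ≤ ε → ε ≤ ‖x - xbar‖ →
      C * ε < Metric.infDist x M → c ≤ ‖goldsteinSubgradient f ε x‖ := by
  obtain ⟨e, T, h⟩ := hM.exists_straightening
  obtain ⟨K, s, hs, hK⟩ := hf xbar
  obtain ⟨μ, hμ, haim⟩ := haim
  have hL : (0 : ℝ) < K + 1 := by positivity
  set L : ℝ := K + 1 with hLdef
  set η := μ / (8 * L) with hη
  obtain ⟨ρ₀, hρ₀, hP⟩ := h.norm_nearestPoint_sub_le (η := η) (by positivity)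
  obtain ⟨ρ₁, hρ₁, hball⟩ := Metric.eventually_nhds_iff_ball.1
    ((eventually_mem_set.2 hs).and (haim.and h.nearestPoint_spec))
  set ρ := min ρ₀ ρ₁
  have hρ : 0 < ρ := lt_min hρ₀ hρ₁
  have hK' : LipschitzOnWith K f (Metric.ball xbar ρ) :=
    hK.mono fun z hz => (hball z (Metric.ball_subset_ball (min_le_right _ _) hz)).1
  refine ⟨(4 * μ + 8 * L) / μ, by positivity, μ / 4, by positivity, ?_⟩
  filter_upwards [Metric.ball_mem_nhds xbar (half_pos hρ)] with x hx ε hε hεx hd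
  rw [mem_ball_iff_norm] at hx
  have hsub : Metric.closedBall x ε ⊆ Metric.ball xbar ρ := by
    refine Metric.closedBall_subset_ball' ?_
    rw [dist_eq_norm]; linarith
  have hxρ := hsub (Metric.mem_closedBall_self hε)
  have hgmem := (goldsteinSubgradient_spec Metric.isOpen_ball hK' hε hsub).1
  have hxd := (hball x (Metric.ball_subset_ball (min_le_right _ _) hxρ)).2.2.2
  rw [dist_eq_norm] at hxd
  set d := Metric.infDist x M with hd_def
  have hd0 : 0 < d := lt_of_le_of_lt (by positivity) hd
  have hεd : (4 * μ + 8 * L) * ε < μ * d := by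
    rw [div_mul_eq_mul_div, div_lt_iff₀ hμ] at hd
    linarith
  have hhalf : goldsteinSubdifferential f ε x ⊆
      {v | μ / 4 * d ≤ inner ℝ (x - nearestPoint M x) v} := by
    refine convexHull_min (Set.iUnion₂_subset fun z hz v hv => ?_)
      (convex_halfSpace_ge (innerSL ℝ (x - nearestPoint M x)).isLinear _)
    have hzρ := hsub hz
    have hz1 := (hball z (Metric.ball_subset_ball (min_le_right _ _) hzρ)).2.1 v hv
    have hPz := hP x (Metric.ball_subset_ball (min_le_left _ _) hxρ) z
      (Metric.ball_subset_ball (min_le_left _ _) hzρ)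
    have hvL : ‖v‖ ≤ L := by
      have := norm_le_of_mem_clarkeSubdifferential Metric.isOpen_ball hK' hzρ hv
      linarith
    have hxz : ‖x - z‖ ≤ ε := by rwa [← dist_eq_norm, dist_comm]
    have hdz1 : d ≤ Metric.infDist z M + ε := by
      have := Metric.infDist_le_infDist_add_dist (s := M) (x := x) (y := z)
      rw [dist_eq_norm] at this; linarith
    have hdz2 : Metric.infDist z M ≤ d + ε := by
      have := Metric.infDist_le_infDist_add_dist (s := M) (x := z) (y := x)
      rw [dist_comm, dist_eq_norm] at this; linarith
    change μ / 4 * d ≤ inner ℝ (x - nearestPoint M x) v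
    rw [real_inner_comm]
    have h1 : inner ℝ v (x - nearestPoint M x) = inner ℝ v (z - nearestPoint M z) +
        inner ℝ v ((x - z) - (nearestPoint M x - nearestPoint M z)) := by
      rw [← inner_add_right]; congr 1; abel
    have h2 : ‖(x - z) - (nearestPoint M x - nearestPoint M z)‖ ≤ 4 * ε + η * (2 * d + ε) := by
      have h3 := norm_sub_le (x - z) (nearestPoint M x - nearestPoint M z)
      have h4 : η * (d + Metric.infDist z M) ≤ η * (2 * d + ε) :=
        mul_le_mul_of_nonneg_left (by linarith) (by positivity)
      linarith
    have h5 : |inner ℝ v ((x - z) - (nearestPoint M x - nearestPoint M z))| ≤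
        L * (4 * ε + η * (2 * d + ε)) :=
      (abs_real_inner_le_norm _ _).trans (by gcongr)
    have h6 : L * (4 * ε + η * (2 * d + ε)) = 4 * L * ε + μ / 8 * (2 * d + ε) := by
      rw [hη]; field_simp
    have h7 : μ * d ≤ μ * (Metric.infDist z M + ε) := by gcongr
    have h8 : 0 ≤ μ * ε := by positivity
    rw [h1]
    linarith [neg_abs_le (inner ℝ v ((x - z) - (nearestPoint M x - nearestPoint M z)))]
  have hfin : μ / 4 * d ≤ d * ‖goldsteinSubgradient f ε x‖ := by
    refine (hhalf hgmem).trans ?_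
    rw [← hxd]
    exact real_inner_le_norm _ _
  refine le_of_mul_le_mul_right ?_ hd0
  linarith

/-- Tempered growth, restated without sequences: near `xbar`, either the Goldstein subgradient is
bounded below or its angle to the Riemannian gradient is small. -/
theorem exists_le_norm_or_angle_lt {θ β : ℝ}
    (hseq : ∀ (x : ℕ → X) (ε : ℕ → ℝ), (∀ r, x r ≠ xbar) → Tendsto x atTop (𝓝 xbar) →
      (∀ r, 0 ≤ ε r ∧ ε r ≤ β * ‖x r - xbar‖) →
      Tendsto (fun r => goldsteinSubgradient f (ε r) (x r)) atTop (𝓝 0) →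
      ∀ᶠ r in atTop, goldsteinSubgradient f (ε r) (x r) ≠ 0 ∧
        riemannianGradient f M (nearestPoint M (x r)) ≠ 0 ∧
        InnerProductGeometry.angle (goldsteinSubgradient f (ε r) (x r))
          (riemannianGradient f M (nearestPoint M (x r))) < θ) :
    ∃ c > 0, ∀ᶠ x in 𝓝 xbar, x ≠ xbar → ∀ ε, 0 ≤ ε → ε ≤ β * ‖x - xbar‖ →
      c ≤ ‖goldsteinSubgradient f ε x‖ ∨
      (goldsteinSubgradient f ε x ≠ 0 ∧ riemannianGradient f M (nearestPoint M x) ≠ 0 ∧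
        InnerProductGeometry.angle (goldsteinSubgradient f ε x)
          (riemannianGradient f M (nearestPoint M x)) < θ) := by
  by_contra! hcon
  have hfreq : ∀ n : ℕ, ∃ x, dist x xbar < 1 / ((n : ℝ) + 1) ∧ x ≠ xbar ∧ ∃ ε, 0 ≤ ε ∧
      ε ≤ β * ‖x - xbar‖ ∧ ‖goldsteinSubgradient f ε x‖ < 1 / ((n : ℝ) + 1) ∧
      ¬(goldsteinSubgradient f ε x ≠ 0 ∧ riemannianGradient f M (nearestPoint M x) ≠ 0 ∧
        InnerProductGeometry.angle (goldsteinSubgradient f ε x)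
          (riemannianGradient f M (nearestPoint M x)) < θ) := by
    intro n
    have hn : 0 < 1 / ((n : ℝ) + 1) := Nat.one_div_pos_of_nat
    obtain ⟨x, ⟨hx, ε, h1, h2, h3, h4⟩, hxd⟩ :=
      ((hcon _ hn).and_eventually (Metric.ball_mem_nhds xbar hn)).exists
    exact ⟨x, hxd, hx, ε, h1, h2, h3, fun ⟨a, b, c⟩ => (h4 a b).not_gt c⟩
  choose x hxd hx ε hε0 hε hg hnot using hfreq
  have hlim : Tendsto x atTop (𝓝 xbar) := tendsto_iff_dist_tendsto_zero.2
    (squeeze_zero (fun _ => dist_nonneg) (fun n => (hxd n).le)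
      tendsto_one_div_add_atTop_nhds_zero_nat)
  have hglim := squeeze_zero_norm (fun n => (hg n).le)
    (tendsto_one_div_add_atTop_nhds_zero_nat (𝕜 := ℝ))
  obtain ⟨r, hr⟩ := (hseq x ε hx hlim (fun r => ⟨hε0 r, hε r⟩) hglim).exists
  exact hnot r hr

theorem eventually_isProportionalityBracket (hM : IsC2ManifoldAround M xbar)
    (hf : LocallyLipschitz f) (hrobust : GrowsRobustly f M xbar)
    (htempered : HasTemperedGrowth f M xbar) :
    ∀ᶠ β : ℝ in 𝓝[>] 0, ∀ γ ∈ Set.Ioo (0 : ℝ) 1, IsProportionalityBracket f xbar (β * γ) β := by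
  obtain ⟨e, T, h⟩ := hM.exists_straightening
  obtain ⟨κ₀, hκ₀, hgrad⟩ := h.exists_inner_riemannianGradient_ge hrobust.growsQuadratically
    hrobust.restriction
  set κ := min κ₀ 1 with hκdef
  have hκ : 0 < κ := lt_min hκ₀ one_pos
  have hκ1 : κ ≤ 1 := min_le_right _ _
  obtain ⟨C, hC, c₀, hc₀, hfar⟩ :=
    exists_le_norm_goldsteinSubgradient_of_lt_infDist hM hf hrobust.aiming
  obtain ⟨K, s, hs, hK⟩ := hf xbar
  obtain ⟨δ, hδ, hgrow⟩ := hrobust.growsQuadratically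
  have hsmall : ∀ᶠ β : ℝ in 𝓝[>] 0, β < min (κ / (8 * C)) (κ / 4) :=
    mem_nhdsWithin_of_mem_nhds (Iio_mem_nhds (by positivity))
  filter_upwards [htempered (κ / 2) (by positivity), hsmall, self_mem_nhdsWithin]
    with β hseq hβsmall hβ γ hγ
  replace hβ : 0 < β := hβ
  have hβC : 8 * C * β ≤ κ := by
    have := hβsmall.le.trans (min_le_left _ _)
    rw [le_div_iff₀ (by positivity)] at this
    linarith
  have hβκ : 4 * β ≤ κ := by linarith [hβsmall.le.trans (min_le_right _ _)]
  obtain ⟨c₁, hc₁, hangle⟩ := exists_le_norm_or_angle_lt hseq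
  set c := min c₀ c₁ with hcdef
  have hc : 0 < c := lt_min hc₀ hc₁
  have hβγ : 0 < β * γ := mul_pos hβ hγ.1
  have hβγβ : β * γ < β := mul_lt_of_lt_one_right hβ hγ.2
  have hL : (0 : ℝ) < K + 1 := by positivity
  set L : ℝ := K + 1 with hLdef
  -- The first entry is the rate of decrease of `f` where the subgradient has norm at least `c`.
  -- The last one is the contraction factor of the distance to `xbar` elsewhere.
  set θ := max (1 - β * γ * c / L) (max (1 / 2) √(1 - κ / 4 * (β * γ))) with hθdef
  have hθ1 : θ < 1 := by
    refine max_lt (sub_lt_self _ (by positivity)) (max_lt (by norm_num) ?_)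
    rw [Real.sqrt_lt' one_pos]
    have : 0 < κ / 4 * (β * γ) := by positivity
    linarith
  have hθ0 : 0 < θ := lt_of_lt_of_le (by norm_num) ((le_max_left _ _).trans (le_max_right _ _))
  refine ⟨hβγ, hβγβ, θ, ⟨hθ0, hθ1⟩, ?_⟩
  obtain ⟨ρ, hρ, hρs⟩ := Metric.mem_nhds_iff.1 hs
  have hK' := hK.mono hρs
  filter_upwards [hfar, hangle, hgrow, h.nearestPoint_spec,
    h.tendsto_nearestPoint.eventually hgrad, Metric.ball_mem_nhds xbar (half_pos hρ)]
    with x hfarx hanglex hgrowx hPx hgradx hxρ hx ε hε1 hε2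
  have ha : 0 < ‖x - xbar‖ := norm_pos_iff.2 (sub_ne_zero.2 hx)
  rw [le_div_iff₀ ha] at hε1
  rw [div_le_iff₀ ha] at hε2
  have hε0 : 0 ≤ ε := le_trans (by positivity) hε1
  have hεa : ε ≤ ‖x - xbar‖ :=
    hε2.trans (mul_le_of_le_one_left ha.le (by linarith))
  rw [mem_ball_iff_norm] at hxρ
  have hsub : Metric.closedBall x ε ⊆ Metric.ball xbar ρ := by
    refine Metric.closedBall_subset_ball' ?_
    rw [dist_eq_norm]; linarith
  have hfx0 : 0 ≤ f x - f xbar := le_trans (by positivity) hgrowx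
  by_cases hgc : c ≤ ‖goldsteinSubgradient f ε x‖
  · refine ⟨norm_pos_iff.1 (hc.trans_le hgc), Or.inl ?_⟩
    have hdesc := goldsteinUpdate_descent Metric.isOpen_ball hK' hε0 hsub
    have hfL : f x - f xbar ≤ L * ‖x - xbar‖ := by
      have := hK'.dist_le_mul x (hsub (Metric.mem_closedBall_self hε0)) xbar
        (Metric.mem_ball_self hρ)
      rw [Real.dist_eq, dist_eq_norm] at this
      nlinarith [le_abs_self (f x - f xbar)]
    have h1 : β * γ * ‖x - xbar‖ * c ≤ ε * ‖goldsteinSubgradient f ε x‖ := by gcongr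
    have h2 : β * γ * c / L * (f x - f xbar) ≤ β * γ * ‖x - xbar‖ * c := by
      calc β * γ * c / L * (f x - f xbar) ≤ β * γ * c / L * (L * ‖x - xbar‖) := by gcongr
        _ = β * γ * ‖x - xbar‖ * c := by field_simp
    calc f (goldsteinUpdate f ε x) - f xbar
        ≤ (1 - β * γ * c / L) * (f x - f xbar) := by linarith
      _ ≤ θ * (f x - f xbar) := by gcongr; exact le_max_left _ _
  · rw [not_le] at hgc
    obtain hbig | ⟨hg, hw, hgw⟩ := hanglex hx ε hε0 hε2
    · exact absurd (hgc.trans_le (min_le_right _ _)) hbig.not_gt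
    refine ⟨hg, Or.inr ?_⟩
    have hd : Metric.infDist x M ≤ C * ε := by
      by_contra! hlt
      exact (hgc.trans_le (min_le_left _ _)).not_ge (hfarx ε hε0 hεa hlt)
    rw [← hPx.2, dist_eq_norm] at hd
    have hwy : κ * (‖riemannianGradient f M (nearestPoint M x)‖ * ‖nearestPoint M x - xbar‖) ≤
        inner ℝ (riemannianGradient f M (nearestPoint M x)) (nearestPoint M x - xbar) := by
      refine le_trans ?_ (hgradx hPx.1)
      gcongr
      exact min_le_left _ _
    have hstep := norm_sub_smul_sq_le (x := x - xbar) (y := nearestPoint M x - xbar) hκ hκ1 hC.le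
      hg (half_mul_norm_mul_norm_le_inner_of_angle_lt hg hw hgw hwy) hε0 hε2 hβC hβκ
      (by rwa [sub_sub_sub_cancel_right])
    have hupd : goldsteinUpdate f ε x - xbar = x - xbar -
        (ε / ‖goldsteinSubgradient f ε x‖) • goldsteinSubgradient f ε x := by
      rw [goldsteinUpdate]; abel
    rw [← hupd] at hstep
    have hpos : 0 ≤ 1 - κ / 4 * (β * γ) := by nlinarith
    have h1 : ‖goldsteinUpdate f ε x - xbar‖ ^ 2 ≤
        (√(1 - κ / 4 * (β * γ)) * ‖x - xbar‖) ^ 2 := by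
      rw [mul_pow, Real.sq_sqrt hpos]
      have : κ / 4 * ‖x - xbar‖ * (β * γ * ‖x - xbar‖) ≤ κ / 4 * ‖x - xbar‖ * ε := by gcongr
      nlinarith
    refine (abs_le_of_sq_le_sq' h1 (by positivity)).2.trans ?_
    gcongr
    exact (le_max_right _ _).trans (le_max_right _ _)

end

/-! ### Nearly linear convergence -/

/-- Among the first `s ^ 2` steps, split into `s` blocks of length `s`, either some block consists
only of steps that contract `a`, or every block contains a step that contracts `F`. -/
theorem le_mul_pow_sqrt_of_alternating_contraction {F a : ℕ → ℝ} {θ L C : ℝ}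
    (hθ0 : 0 ≤ θ) (hθ1 : θ ≤ 1) (hL : 0 ≤ L) (ha : ∀ r, a r ≤ C)
    (hanti : Antitone F) (hFa : ∀ r, F r ≤ L * a r)
    (hstep : ∀ r, F (r + 1) ≤ θ * F r ∨ a (r + 1) ≤ θ * a r) (r : ℕ) :
    F r ≤ L * C * θ ^ Nat.sqrt r := by
  set s := Nat.sqrt r with hs
  have hD : F 0 ≤ L * C := (hFa 0).trans (by gcongr; exact ha 0)
  have hLC : ∀ r, F r ≤ L * C := fun r => (hanti (Nat.zero_le r)).trans hD
  have hblock : ∀ j ≤ s, F (s * j) ≤ L * C * θ ^ j := by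
    intro j
    induction j with
    | zero => intro _; simpa using hD
    | succ j ih =>
      intro hj
      by_cases hex : ∃ i < s, F (s * j + i + 1) ≤ θ * F (s * j + i)
      · obtain ⟨i, hi, hFi⟩ := hex
        calc F (s * (j + 1)) ≤ F (s * j + i + 1) := hanti (by rw [mul_add, mul_one]; omega)
          _ ≤ θ * F (s * j + i) := hFi
          _ ≤ θ * F (s * j) := by gcongr; exact hanti (by omega)
          _ ≤ θ * (L * C * θ ^ j) := by gcongr; exact ih (by omega)
          _ = L * C * θ ^ (j + 1) := by ring
      · push Not at hex
        have hrun : ∀ i ≤ s, a (s * j + i) ≤ θ ^ i * C := by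
          intro i
          induction i with
          | zero => intro _; simpa using ha (s * j)
          | succ i ih' =>
            intro hi
            have h1 := (hstep (s * j + i)).resolve_left (hex i (by omega)).not_ge
            calc a (s * j + (i + 1)) ≤ θ * a (s * j + i) := h1
              _ ≤ θ * (θ ^ i * C) := by gcongr; exact ih' (by omega)
              _ = θ ^ (i + 1) * C := by ring
        have hend := hrun s le_rfl
        rcases le_or_gt 0 (L * C) with hpos | hneg
        · calc F (s * (j + 1)) ≤ L * a (s * j + s) := by rw [mul_add, mul_one]; exact hFa _
            _ ≤ L * (θ ^ s * C) := by gcongr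
            _ = L * C * θ ^ s := by ring
            _ ≤ L * C * θ ^ (j + 1) :=
              mul_le_mul_of_nonneg_left (pow_le_pow_of_le_one hθ0 hθ1 hj) hpos
        · calc F (s * (j + 1)) ≤ L * C := hLC _
            _ ≤ L * C * θ ^ (j + 1) := le_mul_of_le_one_right hneg.le (pow_le_one₀ hθ0 hθ1)
  exact (hanti (Nat.sqrt_le r)).trans (hblock s le_rfl)

section

variable {X : Type*} [NormedAddCommGroup X] [InnerProductSpace ℝ X] [FiniteDimensional ℝ X]
  {f : X → ℝ} {xbar : X}

theorem IsProportionalityBracket.convergesNearlyLinearly {γ β : ℝ}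
    (hbracket : IsProportionalityBracket f xbar (β * γ) β) (hβ1 : β ≤ 1)
    (hf : LocallyLipschitz f) (hgrow : GrowsQuadratically f xbar) :
    ∀ᶠ x₀ in 𝓝 xbar, ∀ x : ℕ → X, x 0 = x₀ → IsGoldsteinIteration f xbar γ β x →
      ConvergesNearlyLinearly x xbar := by
  obtain ⟨hβγ, hβγβ, θ, ⟨hθ0, hθ1⟩, hprop⟩ := hbracket
  have hβ : 0 < β := hβγ.trans hβγβ
  obtain ⟨K, s, hs, hK⟩ := hf xbar
  obtain ⟨δ, hδ, hgrow⟩ := hgrow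
  obtain ⟨ρ, hρ, hball⟩ := Metric.eventually_nhds_iff_ball.1
    ((eventually_mem_set.2 hs).and (hgrow.and hprop))
  have hK' : LipschitzOnWith K f (Metric.ball xbar ρ) := hK.mono fun z hz => (hball z hz).1
  have hL : (0 : ℝ) < K + 1 := by positivity
  set L : ℝ := K + 1 with hLdef
  have hfL : ∀ z ∈ Metric.ball xbar ρ, f z - f xbar ≤ L * ‖z - xbar‖ := by
    intro z hz
    have := hK'.dist_le_mul z hz xbar (Metric.mem_ball_self hρ)
    rw [Real.dist_eq, dist_eq_norm] at this
    nlinarith [le_abs_self (f z - f xbar), norm_nonneg (z - xbar)]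
  have hinit : ∀ᶠ x₀ in 𝓝 xbar, ‖x₀ - xbar‖ < min (ρ / 2) (δ / 2 * (ρ / 2) ^ 2 / L) := by
    have hpos : 0 < min (ρ / 2) (δ / 2 * (ρ / 2) ^ 2 / L) := by positivity
    filter_upwards [Metric.ball_mem_nhds xbar hpos] with x₀ hx₀
    rwa [mem_ball_iff_norm] at hx₀
  filter_upwards [hinit] with x₀ hx₀ x hx0 hiter
  obtain ⟨hx₀ρ, hx₀δ⟩ := lt_min_iff.1 hx₀
  have hhalf : ∀ z, ‖z - xbar‖ < ρ / 2 → z ∈ Metric.ball xbar ρ := fun z hz => by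
    rw [mem_ball_iff_norm]; linarith
  have hstep : ∀ r, ‖x r - xbar‖ < ρ / 2 → x (r + 1) ∈ Metric.ball xbar ρ ∧
      f (x (r + 1)) ≤ f (x r) ∧ (f (x (r + 1)) - f xbar ≤ θ * (f (x r) - f xbar) ∨
        ‖x (r + 1) - xbar‖ ≤ θ * ‖x r - xbar‖) := by
    intro r hr
    by_cases hxr : x r = xbar
    · rw [(hiter r).1 hxr, hxr]
      simp [hρ]
    · obtain ⟨ε, hε1, hε2, hnext⟩ := (hiter r).2 hxr
      have ha : 0 < ‖x r - xbar‖ := norm_pos_iff.2 (sub_ne_zero.2 hxr)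
      rw [le_div_iff₀ (by positivity)] at hε1
      rw [div_le_iff₀ (by positivity), one_mul] at hε2
      have hε0 : 0 ≤ ε := le_trans (by nlinarith) hε1
      have hεa : ε ≤ ‖x r - xbar‖ := hε2.trans (mul_le_of_le_one_left ha.le hβ1)
      have hsub : Metric.closedBall (x r) ε ⊆ Metric.ball xbar ρ := by
        refine Metric.closedBall_subset_ball' ?_
        rw [dist_eq_norm]; linarith
      have hdec := (hball _ (hhalf _ hr)).2.2 hxr ε
        (by rw [le_div_iff₀ ha]; linarith) (by rwa [div_le_iff₀ ha])
      have hdesc := goldsteinUpdate_descent Metric.isOpen_ball hK' hε0 hsub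
      rw [← hnext] at hdec hdesc
      refine ⟨hsub ?_, ?_, hdec.2⟩
      · rw [mem_closedBall_iff_norm, hnext]
        exact norm_goldsteinUpdate_sub_le hε0
      · have : 0 ≤ ε * ‖goldsteinSubgradient f ε (x r)‖ := by positivity
        linarith
  -- Quadratic growth and monotonicity of `f` trap the iterates in the smaller ball.
  have htrap : ∀ r, ‖x r - xbar‖ < ρ / 2 ∧ f (x r) ≤ f x₀ := by
    intro r
    induction r with
    | zero => rw [hx0]; exact ⟨hx₀ρ, le_rfl⟩
    | succ r ih =>
      obtain ⟨h1, h2, -⟩ := hstep r ih.1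
      refine ⟨?_, h2.trans ih.2⟩
      have h3 := (hball _ h1).2.1
      have h4 := hfL x₀ (hhalf _ hx₀ρ)
      rw [lt_div_iff₀ hL] at hx₀δ
      have h5 : δ / 2 * ‖x (r + 1) - xbar‖ ^ 2 < δ / 2 * (ρ / 2) ^ 2 := by
        linarith [h2.trans ih.2]
      exact lt_of_pow_lt_pow_left₀ 2 (by positivity) (lt_of_mul_lt_mul_left h5 (by positivity))
  have hrate := le_mul_pow_sqrt_of_alternating_contraction
    (F := fun r => f (x r) - f xbar) (a := fun r => ‖x r - xbar‖) (C := ρ / 2) hθ0.le hθ1.le hL.le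
    (fun r => (htrap r).1.le)
    (antitone_nat_of_succ_le fun r => by linarith [(hstep r (htrap r).1).2.1])
    (fun r => hfL _ (hhalf _ (htrap r).1)) (fun r => (hstep r (htrap r).1).2.2)
  set D := L * (ρ / 2) with hD
  have hD0 : 0 < D := by positivity
  have hlog : Real.log θ < 0 := Real.log_neg hθ0 hθ1
  refine ⟨√(2 / δ * D / θ), -Real.log θ / 2, by positivity, by linarith, fun r => ?_⟩
  refine (abs_le_of_sq_le_sq' ?_ (by positivity)).2
  have hsqrt : √(r : ℝ) ≤ Nat.sqrt r + 1 := Real.real_sqrt_le_nat_sqrt_succ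
  have hpow : θ ^ Nat.sqrt r ≤ Real.exp (Real.log θ * √(r : ℝ)) / θ := by
    rw [le_div_iff₀ hθ0, ← pow_succ, ← Real.exp_log (pow_pos hθ0 _), Real.log_pow,
      Real.exp_le_exp]
    push_cast
    nlinarith
  have hg := (hball _ (hhalf _ (htrap r).1)).2.1
  have hexp : Real.exp (-(-Real.log θ / 2) * √(r : ℝ)) ^ 2 = Real.exp (Real.log θ * √(r : ℝ)) := by
    rw [← Real.exp_nat_mul]
    congr 1
    push_cast
    ring
  rw [mul_pow, Real.sq_sqrt (by positivity), hexp]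
  calc ‖x r - xbar‖ ^ 2 = 2 / δ * (δ / 2 * ‖x r - xbar‖ ^ 2) := by field_simp
    _ ≤ 2 / δ * (D * (Real.exp (Real.log θ * √(r : ℝ)) / θ)) := by
        refine mul_le_mul_of_nonneg_left ?_ (by positivity)
        exact hg.trans ((hrate r).trans (mul_le_mul_of_nonneg_left hpow hD0.le))
    _ = 2 / δ * D / θ * Real.exp (Real.log θ * √(r : ℝ)) := by field_simp

end

theorem mainTheorem2 {X : Type*} [NormedAddCommGroup X] [InnerProductSpace ℝ X]
    [FiniteDimensional ℝ X] (f : X → ℝ) (M : Set X) (xbar : X)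
    (hM : IsC2ManifoldAround M xbar) (hf : LocallyLipschitz f)
    (hrobust : GrowsRobustly f M xbar) (htempered : HasTemperedGrowth f M xbar) :
    HasGoldsteinProperty f xbar ∧
    ∀ γ ∈ Set.Ioo (0 : ℝ) 1, ∀ᶠ β : ℝ in 𝓝[>] 0,
      IsProportionalityBracket f xbar (β * γ) β ∧
      ∀ᶠ x₀ in 𝓝 xbar, ∀ x : ℕ → X, x 0 = x₀ → IsGoldsteinIteration f xbar γ β x →
        ConvergesNearlyLinearly x xbar := by
  have hbracket := eventually_isProportionalityBracket hM hf hrobust htempered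
  constructor
  · obtain ⟨β, hβ⟩ := hbracket.exists
    exact ⟨β * (1 / 2), β, hβ (1 / 2) (by norm_num)⟩
  · intro γ hγ
    filter_upwards [hbracket, mem_nhdsWithin_of_mem_nhds (Iic_mem_nhds zero_lt_one)] with β hβ hβ1
    exact ⟨hβ γ hγ,
      (hβ γ hγ).convergesNearlyLinearly hβ1 hf hrobust.growsQuadratically⟩
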